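/- Let $T$ be a generalized star with central vertex $v$ and $k$ arms, i.e. the tree obtained by joining $v$ to one end of each of $k$ disjoint paths with $n_1,\dots,n_k\ge 1$ vertices, and let $A$ be a real symmetric matrix with graph $T$: for $x\neq y$ the entry $A_{xy}$ is nonzero if and only if $xy$ is an edge of $T$ (the diagonal is arbitrary). Write $m_A(x)\ge 0$ for the multiplicity of $x$ as an eigenvalue of $A$, and $A(v)$ for $A$ with the row and column of $v$ removed. A real number $x$ is an upward eigenvalue of $A$ if $m_{A(v)}(x)=m_A(x)+1$, where $m_A(x)=0$ is allowed; an eigenvalue of $A$ that is not upward is called non-upward. Let $\hat\mu_2<\hat\mu_4<\dots<\hat\mu_{2u}$ be all the distinct upward eigenvalues of $A$, $(\hat q_1,\dots,\hat q_u)$ with $\hat q_j=m_A(\hat\mu_{2j})$ the upward multiplicity list, and $\lambda_1<\lambda_3<\dots<\lambda_{2u+1}$ all the distinct non-upward eigenvalues. Let $a_0=A_{vv}$, let $a_i$ be the entry of $A$ at the edge joining $v$ to arm $i$, let $B_i$ be the $n_i\times n_i$ principal submatrix of $A$ on arm $i$, ordered outwards from $v$, and let $B_i(1)$ be $B_i$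 with its first row and column removed. The eigenvalues of each $B_i$ are distinct, as are those of each $B_i(1)$. On the real symmetric matrices with graph $T$, near $A$, the numbers $$a_0,\qquad a_i\ (1\le i\le k),\qquad \gamma^{(i)}_1<\dots<\gamma^{(i)}_{n_i}\ \text{(the eigenvalues of $B_i$)},\qquad \eta^{(i)}_1<\dots<\eta^{(i)}_{n_i-1}\ \text{(the eigenvalues of $B_i(1)$)}$$ form a smooth system of variables: there is a $C^\infty$ map $x\mapsto M(x)$, defined on an open neighbourhood of the values $x^0$ that these numbers take at $A$, such that $M(x^0)=A$ and such that $M(x)$ is a real symmetric matrix with graph $T$ for which these numbers have the values $x$. With respect to such variables one can select $u+1$ distinct ones, namely $a_0$, some of the $a_i$, and some of the $\eta^{(i)}_j$, where $\eta^{(i)}_j$ is selected only if $a_i$ is, such that the $(u+1)\times(u+1)$ Jacobian matrix of $$F=\bigl(\det(M(x)-\lambda_1 I),\ \det(M(x)-\lambda_3 I),\ \dots,\ \det(M(x)-\lambda_{2u+1}I)\bigr)$$ with respect to the selected variables is nonsingular at $x=x^0$. -/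

import Mathlib

open scoped ContDiff

namespace GenStar

/-- Vertices of the generalized star with `k` arms of lengths `n 0, …, n (k-1)`: the central
vertex `none`, and the `p`-th vertex of arm `i`, `some ⟨i, p⟩`, counted outwards from `p = 0`. -/
abbrev Vertex {k : ℕ} (n : Fin k → ℕ) : Type := Option (Σ i : Fin k, Fin (n i))

/-- One orientation of the edges: from the centre to the first vertex of each arm, and from each
vertex of an arm to the next vertex of the same arm. -/
def edgeRel {k : ℕ} (n : Fin k → ℕ) : Vertex n → Vertex n → Prop
  | none, some b => b.2.val = 0
  | some a, some b => a.1 = b.1 ∧ b.2.val = a.2.val + 1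
  | _, none => False

/-- The generalized star with `k` arms of lengths `n i`. -/
def starGraph {k : ℕ} (n : Fin k → ℕ) : SimpleGraph (Vertex n) :=
  SimpleGraph.fromRel (edgeRel n)

/-- `𝒮(G)`: the real symmetric matrices whose nonzero off-diagonal entries are exactly those at
the edges of `G`; the diagonal is unrestricted. -/
def MatricesWithGraph {V : Type*} (G : SimpleGraph V) : Set (Matrix V V ℝ) :=
  {A | A.IsSymm ∧ ∀ v w, v ≠ w → (A v w ≠ 0 ↔ G.Adj v w)}

/-- The principal submatrix `A(v)`, with the row and column of `v` removed. -/
def deleteVertex {V : Type*} (A : Matrix V V ℝ) (v : V) : Matrix {w // w ≠ v} {w // w ≠ v} ℝ :=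
  A.submatrix Subtype.val Subtype.val

/-- `m_A(x)`: the multiplicity (possibly `0`) of `x` as an eigenvalue of `A`. -/
noncomputable def mult {V : Type*} [Fintype V] [DecidableEq V] (A : Matrix V V ℝ) (x : ℝ) : ℕ :=
  A.charpoly.rootMultiplicity x

/-- `x` is an upward eigenvalue of `A` at `v`: its multiplicity increases by one when `v` is
removed. Upward multiplicity `m_A(x) = 0` is allowed. -/
def IsUpward {V : Type*} [Fintype V] [DecidableEq V] (A : Matrix V V ℝ) (v : V) (x : ℝ) : Prop :=
  mult (deleteVertex A v) x = mult A x + 1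

/-- `x` is a non-upward eigenvalue of `A` at `v`. -/
def IsNonUpwardEigenvalue {V : Type*} [Fintype V] [DecidableEq V] (A : Matrix V V ℝ) (v : V)
    (x : ℝ) : Prop :=
  0 < mult A x ∧ ¬ IsUpward A v x

/-- Relative to the vertex `v`, the matrix `A` has complete upward multiplicity list `q`, attached
to its distinct upward eigenvalues `μ 0 < … < μ (u-1)`, and its distinct non-upward eigenvalues are
`lam 0 < … < lam u`. (In the numbering by a common list, `μ j` is the entry `2 j + 2` and `lam j`
the entry `2 j + 1`.) -/
structure HasUpwardList {V : Type*} [Fintype V] [DecidableEq V] (A : Matrix V V ℝ) (v : V)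
    {u : ℕ} (q : Fin u → ℕ) (μ : Fin u → ℝ) (lam : Fin (u + 1) → ℝ) : Prop where
  mu_strictMono : StrictMono μ
  lam_strictMono : StrictMono lam
  isUpward_iff : ∀ x, IsUpward A v x ↔ ∃ j, μ j = x
  mult_mu : ∀ j, mult A (μ j) = q j
  isNonUpward_iff : ∀ x, IsNonUpwardEigenvalue A v x ↔ ∃ j, lam j = x

/-- The block `B_i` of `A` on the vertices of arm `i`. -/
def arm {k : ℕ} {n : Fin k → ℕ} (A : Matrix (Vertex n) (Vertex n) ℝ) (i : Fin k) :
    Matrix (Fin (n i)) (Fin (n i)) ℝ :=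
  A.submatrix (fun p => some ⟨i, p⟩) (fun p => some ⟨i, p⟩)

/-- `B_i(1)`: the block `B_i` without its first row and column (those of the vertex of the arm
that is adjacent to the centre). -/
def armTail {k : ℕ} {n : Fin k → ℕ} (A : Matrix (Vertex n) (Vertex n) ℝ) (i : Fin k) :
    Matrix {p : Fin (n i) // p.val ≠ 0} {p : Fin (n i) // p.val ≠ 0} ℝ :=
  (arm A i).submatrix Subtype.val Subtype.val

/-- Labels of the variables on which a matrix of the generalized star depends: the central diagonal
entry `a_0`, the entries `a_i` at the edges between the centre and the arms, the eigenvalues of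
the blocks `B_i`, and the eigenvalues of the blocks `B_i(1)`. -/
abbrev Var {k : ℕ} (n : Fin k → ℕ) : Type :=
  Unit ⊕ Fin k ⊕ (Σ i : Fin k, Fin (n i)) ⊕ (Σ i : Fin k, Fin (n i - 1))

/-- The variable `a_0`. -/
abbrev Var.center {k : ℕ} {n : Fin k → ℕ} : Var n := Sum.inl ()

/-- The variable `a_i`. -/
abbrev Var.edge {k : ℕ} {n : Fin k → ℕ} (i : Fin k) : Var n := Sum.inr (Sum.inl i)

/-- The `j`-th eigenvalue of `B_i`. -/
abbrev Var.armEig {k : ℕ} {n : Fin k → ℕ} (i : Fin k) (j : Fin (n i)) : Var n :=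
  Sum.inr (Sum.inr (Sum.inl ⟨i, j⟩))

/-- The `j`-th eigenvalue of `B_i(1)`. -/
abbrev Var.tailEig {k : ℕ} {n : Fin k → ℕ} (i : Fin k) (j : Fin (n i - 1)) : Var n :=
  Sum.inr (Sum.inr (Sum.inr ⟨i, j⟩))

/-- `x` lists the values of the variables of the matrix `A`; the eigenvalues of each `B_i` and of
each `B_i(1)` are distinct and listed in increasing order, so `A` determines `x`. -/
structure HasVars {k : ℕ} {n : Fin k → ℕ} (A : Matrix (Vertex n) (Vertex n) ℝ)
    (x : Var n → ℝ) : Prop where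
  center : A none none = x Var.center
  edge : ∀ (i : Fin k) (p : Fin (n i)), p.val = 0 → A none (some ⟨i, p⟩) = x (Var.edge i)
  arm_strictMono : ∀ i, StrictMono fun j => x (Var.armEig i j)
  arm_charpoly : ∀ i, (arm A i).charpoly =
    ∏ j, (Polynomial.X - Polynomial.C (x (Var.armEig i j)))
  tail_strictMono : ∀ i, StrictMono fun j => x (Var.tailEig i j)
  tail_charpoly : ∀ i, (armTail A i).charpoly =
    ∏ j, (Polynomial.X - Polynomial.C (x (Var.tailEig i j)))

/-- `M` is a smooth parametrization, by the variables `x` in an open neighbourhood `U` of `x₀`, of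
matrices of the generalized star, with `M x₀ = A`. The number of variables is the number of
vertices and edges, and `x` can be recovered from `M x`, so `x ↦ M x` is a smooth change of
variables on the matrices of the star near `A`. -/
structure IsLocalParametrization {k : ℕ} {n : Fin k → ℕ} (A : Matrix (Vertex n) (Vertex n) ℝ)
    (x₀ : Var n → ℝ) (U : Set (Var n → ℝ))
    (M : (Var n → ℝ) → Matrix (Vertex n) (Vertex n) ℝ) : Prop where
  isOpen : IsOpen U
  mem : x₀ ∈ U
  apply_base : M x₀ = A
  contDiffOn : ∀ v w, ContDiffOn ℝ ∞ (fun x => M x v w) U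
  mem_graph : ∀ x ∈ U, M x ∈ MatricesWithGraph (starGraph n)
  hasVars : ∀ x ∈ U, HasVars (M x) x

/-- The Jacobian matrix at `x₀` of the functions `f j` with respect to the selected variables
`s c`: the entry `(j, c)` is the partial derivative of `f j` with respect to `s c`. -/
noncomputable def jacobian {ι κ σ : Type*} [DecidableEq σ] (f : ι → (σ → ℝ) → ℝ) (x₀ : σ → ℝ)
    (s : κ → σ) : Matrix ι κ ℝ :=
  Matrix.of fun j c => deriv (fun t => f j (Function.update x₀ (s c) t)) (x₀ (s c))

end GenStar

namespace GenStar

open Polynomial Filter Topology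

/-! Let `p_i`, `r_i` be the characteristic polynomials of `B_i` and `B_i(1)`. A Schur complement
gives the secular equation `det(tI - A) = (∏ p_i(t)) f(t)` with `f(t) = t - a_0 - ∑ a_i²
r_i(t)/p_i(t)` (`eval_charpoly_star`). The Wronskian `p_i' r_i - p_i r_i'` is positive everywhere
(`wronskian_jacobi_pos`), so the `γ`'s of an arm are simple, differ from its `η`'s, and are poles of
`r_i/p_i` with positive residue. Poles shared by several arms therefore cannot cancel, and the
upward eigenvalues are exactly the `γ`'s (`isUpward_iff_exists_arm`).

At a non-upward `λ_l` the factor `∏ p_i` is nonzero, and it does not involve the selected variables.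
Up to a nonzero factor per row, the Jacobian thus consists of the derivatives of `f` at the `λ_l`:
`-1` for `a_0`, `-2 a_i r_i/p_i` for `a_i`, and `a_i² r_i/((t - η) p_i)` for `η`. All lie in the
span of `1` and the `u` simple fractions `1/(t - μ_j)`, and evaluation at the `u + 1` points `λ_l`
is injective there (`linearIndependent_simpleFraction`).

It remains to choose a basis among these derivatives. Those of arm `i` span the simple fractions at
the poles of that arm (`exists_simpleFraction_eq`), and the one for `a_i` involves all of these
poles with nonzero coefficients. Adding arms one at a time, either the `a_i` derivative is already
in the span, and then so are all poles of the arm, or it is added and completed by `η` derivatives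
(`exists_linearIndepOn_selection`). This yields the rule that `η` is selected only with `a_i`.

The smooth variables come from the inverse spectral problem for Jacobi matrices, solved by running
the three-term recurrence backwards (`exists_jacobi_family`). -/

/-! ### Jacobi matrices: recurrence, Wronskian, simple spectrum. -/

theorem apply_eq_zero_of_val_add_one_lt {N : ℕ} {B : Matrix (Fin N) (Fin N) ℝ}
    (hB : B ∈ MatricesWithGraph (SimpleGraph.pathGraph N)) {p q : Fin N}
    (h : p.val + 1 < q.val) : B p q = 0 := by
  by_contra hne
  have := (hB.2 p q (by intro h'; subst h'; omega)).1 hne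
  rw [SimpleGraph.pathGraph_adj] at this
  omega

theorem submatrix_succ_mem {N : ℕ} {B : Matrix (Fin (N + 1)) (Fin (N + 1)) ℝ}
    (hB : B ∈ MatricesWithGraph (SimpleGraph.pathGraph (N + 1))) :
    B.submatrix Fin.succ Fin.succ ∈ MatricesWithGraph (SimpleGraph.pathGraph N) := by
  refine ⟨hB.1.submatrix _, fun p q hpq => ?_⟩
  rw [Matrix.submatrix_apply, hB.2 _ _ ((Fin.succ_injective _).ne hpq)]
  simp [SimpleGraph.pathGraph_adj]

theorem apply_zero_one_ne_zero {N : ℕ} {B : Matrix (Fin (N + 2)) (Fin (N + 2)) ℝ}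
    (hB : B ∈ MatricesWithGraph (SimpleGraph.pathGraph (N + 2))) : B 0 1 ≠ 0 := by
  rw [hB.2 0 1 (by simp)]
  simp [SimpleGraph.pathGraph_adj]

/-- The three-term recurrence for the characteristic polynomials of a Jacobi matrix. -/
theorem charpoly_jacobi {N : ℕ} {B : Matrix (Fin (N + 2)) (Fin (N + 2)) ℝ}
    (hB : B ∈ MatricesWithGraph (SimpleGraph.pathGraph (N + 2))) :
    B.charpoly = (X - C (B 0 0)) * (B.submatrix Fin.succ Fin.succ).charpoly
      - C (B 0 1 ^ 2) *
        ((B.submatrix Fin.succ Fin.succ).submatrix Fin.succ Fin.succ).charpoly := by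
  have hz : ∀ j : Fin N, B 0 j.succ.succ = 0 := fun j =>
    apply_eq_zero_of_val_add_one_lt hB (by simp)
  have hz' : ∀ j : Fin N, B j.succ.succ 0 = 0 := fun j => by
    rw [← hB.1.apply]; exact hz j
  have hs : B 1 0 = B 0 1 := hB.1.apply 0 1
  have e : ∀ {K : ℕ} (D : Matrix (Fin (K + 1)) (Fin (K + 1)) ℝ),
      (D.submatrix Fin.succ Fin.succ).charpoly = (D.charmatrix.submatrix Fin.succ Fin.succ).det := by
    intro K D
    rw [Matrix.charpoly]
    congr 1
    ext p q : 2
    by_cases h : p = q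
    · subst h; simp
    · rw [Matrix.charmatrix_apply_ne _ _ _ h, Matrix.submatrix_apply, Matrix.submatrix_apply,
        Matrix.charmatrix_apply_ne _ _ _ ((Fin.succ_injective _).ne h)]
  have e2 : ((B.submatrix Fin.succ Fin.succ).submatrix Fin.succ Fin.succ).charpoly
      = ((B.charmatrix.submatrix Fin.succ (Fin.succAbove 1)).submatrix
          (Fin.succAbove 0) Fin.succ).det := by
    rw [Matrix.charpoly]
    congr 1
    ext p q : 2
    by_cases h : p = q
    · subst h
      simp [Fin.succAbove, Fin.lt_def]
    · rw [Matrix.charmatrix_apply_ne _ _ _ h]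
      have h2 : p.succ.succ ≠ q.succ.succ := by simpa using h
      simp [Fin.succAbove, Fin.lt_def, Matrix.charmatrix_apply_ne _ _ _ h2]
  -- The first column of this minor has a single nonzero entry, so a second expansion leaves the
  -- twice-deleted block.
  have h1 : (B.charmatrix.submatrix Fin.succ (Fin.succAbove 1)).det
      = -C (B 0 1) *
        ((B.submatrix Fin.succ Fin.succ).submatrix Fin.succ Fin.succ).charpoly := by
    rw [Matrix.det_succ_column_zero, Fin.sum_univ_succ, Finset.sum_eq_zero, add_zero, e2]
    · simp [Fin.succAbove, hs]
    · intro j _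
      simp [Fin.succAbove, hz']
  rw [e B, Matrix.charpoly, Matrix.det_succ_row_zero, Fin.sum_univ_succ, Fin.sum_univ_succ,
    Finset.sum_eq_zero, add_zero]
  · simp only [Fin.succ_zero_eq_one, h1]
    simp
    ring
  · intro j _
    have : (0 : Fin (N + 2)) ≠ j.succ.succ := by simp [Fin.ext_iff]
    simp [Matrix.charmatrix_apply_ne _ _ _ this, hz]

/-- The Wronskian of the characteristic polynomials of a Jacobi matrix and of its trailing
principal submatrix is everywhere positive. -/
theorem wronskian_jacobi_pos {N : ℕ} {B : Matrix (Fin (N + 1)) (Fin (N + 1)) ℝ}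
    (hB : B ∈ MatricesWithGraph (SimpleGraph.pathGraph (N + 1))) (t : ℝ) :
    0 < B.charpoly.derivative.eval t * (B.submatrix Fin.succ Fin.succ).charpoly.eval t
      - B.charpoly.eval t * (B.submatrix Fin.succ Fin.succ).charpoly.derivative.eval t := by
  induction N with
  | zero => simp [Matrix.charpoly]
  | succ N ih =>
    have h := ih (submatrix_succ_mem hB)
    have hb := pow_pos (abs_pos.2 (apply_zero_one_ne_zero hB)) 2
    rw [sq_abs] at hb
    rw [charpoly_jacobi hB]
    simp only [derivative_sub, derivative_mul, derivative_X, derivative_C, eval_sub, eval_mul,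
      eval_add, eval_X, eval_C, eval_one, eval_zero]
    -- With `r` the characteristic polynomial of the trailing block and `b` the corner edge, the
    -- recurrence makes the Wronskian equal to `r² + b² W`, where `W` is the Wronskian of the
    -- trailing block.
    nlinarith [mul_pos hb h, sq_nonneg (eval t (B.submatrix Fin.succ Fin.succ).charpoly)]

/-- The roots are real by symmetry and simple because the Wronskian vanishes at a double root. -/
theorem exists_strictMono_charpoly_eq {N : ℕ} {B : Matrix (Fin N) (Fin N) ℝ}
    (hB : B ∈ MatricesWithGraph (SimpleGraph.pathGraph N)) :
    ∃ γ : Fin N → ℝ, StrictMono γ ∧ B.charpoly = ∏ j, (X - C (γ j)) := by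
  have hH : B.IsHermitian := by
    rw [Matrix.IsHermitian, Matrix.conjTranspose_eq_transpose_of_trivial]; exact hB.1
  have hc := hH.charpoly_eq
  simp only [RCLike.ofReal_real_eq_id, id] at hc
  refine ⟨hH.eigenvalues ∘ Tuple.sort hH.eigenvalues,
    (Tuple.monotone_sort _).strictMono_of_injective
      (Function.Injective.comp ?_ (Equiv.injective _)), ?_⟩
  · intro i j hij
    by_contra hne
    obtain ⟨K, rfl⟩ : ∃ K, N = K + 1 := ⟨N - 1, by have := i.isLt; omega⟩
    have hw := wronskian_jacobi_pos hB (hH.eigenvalues i)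
    have hd : (X - C (hH.eigenvalues i)) ^ 2 ∣ B.charpoly := by
      rw [hc, ← Finset.mul_prod_erase _ _ (Finset.mem_univ i),
        ← Finset.mul_prod_erase _ _ (Finset.mem_erase.2 ⟨Ne.symm hne, Finset.mem_univ j⟩), ← hij,
        ← mul_assoc, ← sq]
      exact dvd_mul_right _ _
    obtain ⟨Q, hQ⟩ := hd
    simp [hQ, derivative_pow] at hw
  · rw [hc]
    exact (Equiv.prod_comp _ fun j => (X - C (hH.eigenvalues j))).symm

/-! ### Smooth reconstruction of a Jacobi matrix from two spectra. -/

/-- The matrix obtained from `J` by adding a first row and column, with diagonal entry `d` and a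
single nonzero off-diagonal entry `b`. -/
def jacobiCons {N : ℕ} (d b : ℝ) (J : Matrix (Fin (N + 1)) (Fin (N + 1)) ℝ) :
    Matrix (Fin (N + 2)) (Fin (N + 2)) ℝ :=
  Matrix.of fun p q =>
    Fin.cases (Fin.cases d (fun q => if q = 0 then b else 0) q)
      (fun p => Fin.cases (if p = 0 then b else 0) (fun q => J p q) q) p

theorem jacobiCons_zero_succ {N : ℕ} (d b : ℝ) (J : Matrix (Fin (N + 1)) (Fin (N + 1)) ℝ)
    (q : Fin (N + 1)) : jacobiCons d b J 0 q.succ = if q = 0 then b else 0 := rfl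

theorem jacobiCons_succ_zero {N : ℕ} (d b : ℝ) (J : Matrix (Fin (N + 1)) (Fin (N + 1)) ℝ)
    (p : Fin (N + 1)) : jacobiCons d b J p.succ 0 = if p = 0 then b else 0 := rfl

theorem jacobiCons_mem {N : ℕ} {d b : ℝ} (hb : b ≠ 0) {J : Matrix (Fin (N + 1)) (Fin (N + 1)) ℝ}
    (hJ : J ∈ MatricesWithGraph (SimpleGraph.pathGraph (N + 1))) :
    jacobiCons d b J ∈ MatricesWithGraph (SimpleGraph.pathGraph (N + 2)) := by
  refine ⟨Matrix.IsSymm.ext fun p q => ?_, fun p q hpq => ?_⟩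
  · refine Fin.cases ?_ (fun p => ?_) p <;> refine Fin.cases ?_ (fun q => ?_) q <;>
      simp [jacobiCons, hJ.1.apply]
  · rw [SimpleGraph.pathGraph_adj]
    revert hpq
    refine Fin.cases ?_ (fun p => ?_) p <;> refine Fin.cases ?_ (fun q => ?_) q
    · simp
    · rw [jacobiCons_zero_succ]
      by_cases h : q = 0
      · simp [h, hb]
      · have := Fin.val_ne_zero_iff.2 h
        simp [h]
    · rw [jacobiCons_succ_zero]
      by_cases h : p = 0
      · simp [h, hb]
      · have := Fin.val_ne_zero_iff.2 h
        simp [h]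
    · intro hpq
      have := hJ.2 p q (by simpa using hpq)
      rw [SimpleGraph.pathGraph_adj] at this
      simpa [jacobiCons] using this

theorem jacobiCons_submatrix {N : ℕ} (d b : ℝ) (J : Matrix (Fin (N + 1)) (Fin (N + 1)) ℝ) :
    (jacobiCons d b J).submatrix Fin.succ Fin.succ = J := by
  ext p q
  simp [jacobiCons]

theorem jacobiCons_eq {N : ℕ} {B : Matrix (Fin (N + 2)) (Fin (N + 2)) ℝ}
    (hB : B ∈ MatricesWithGraph (SimpleGraph.pathGraph (N + 2))) :
    jacobiCons (B 0 0) (B 0 1) (B.submatrix Fin.succ Fin.succ) = B := by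
  have h : ∀ q : Fin (N + 1), (if q = 0 then B 0 1 else 0) = B 0 q.succ := by
    refine Fin.cases (by simp) fun q => ?_
    rw [if_neg (Fin.succ_ne_zero q), apply_eq_zero_of_val_add_one_lt hB (by simp)]
  ext p q
  refine Fin.cases ?_ (fun p => ?_) p <;> refine Fin.cases ?_ (fun q => ?_) q
  · simp [jacobiCons]
  · simp [jacobiCons, h]
  · simp [jacobiCons, h, hB.1.apply]
  · simp [jacobiCons]

/-- If `P` and `R` are families of monic polynomials, with degrees `N + 1` and `N` and with
smooth coefficients, that specialize at `x₀` to the characteristic polynomials of a Jacobi matrix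
`B` and of its trailing principal submatrix, then near `x₀` they are the characteristic
polynomials of a smooth family of Jacobi matrices through `B`. -/
theorem exists_jacobi_family {E : Type*} [NormedAddCommGroup E] [NormedSpace ℝ E] (x₀ : E) {N : ℕ}
    {B : Matrix (Fin (N + 1)) (Fin (N + 1)) ℝ}
    (hB : B ∈ MatricesWithGraph (SimpleGraph.pathGraph (N + 1))) (P R : E → ℝ[X])
    (hPm : ∀ᶠ x in 𝓝 x₀, (P x).Monic ∧ (P x).natDegree = N + 1)
    (hRm : ∀ᶠ x in 𝓝 x₀, (R x).Monic ∧ (R x).natDegree = N)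
    (hPs : ∀ m, ∀ᶠ x in 𝓝 x₀, ContDiffAt ℝ ∞ (fun y => (P y).coeff m) x)
    (hRs : ∀ m, ∀ᶠ x in 𝓝 x₀, ContDiffAt ℝ ∞ (fun y => (R y).coeff m) x)
    (hP : P x₀ = B.charpoly) (hR : R x₀ = (B.submatrix Fin.succ Fin.succ).charpoly) :
    ∃ J : E → Matrix (Fin (N + 1)) (Fin (N + 1)) ℝ, J x₀ = B ∧ ∀ᶠ x in 𝓝 x₀,
      J x ∈ MatricesWithGraph (SimpleGraph.pathGraph (N + 1)) ∧
      (∀ p q, ContDiffAt ℝ ∞ (fun y => J y p q) x) ∧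
      (J x).charpoly = P x ∧ ((J x).submatrix Fin.succ Fin.succ).charpoly = R x := by
  induction N generalizing P R with
  | zero =>
    refine ⟨fun x => Matrix.of fun _ _ => -(P x).coeff 0, ?_, ?_⟩
    · ext p q
      obtain rfl : p = 0 := Fin.fin_one_eq_zero p
      obtain rfl : q = 0 := Fin.fin_one_eq_zero q
      simp [hP, Matrix.charpoly]
    · filter_upwards [hPm, hRm, hPs 0] with x h1 h2 h3
      refine ⟨⟨Matrix.IsSymm.ext fun p q => rfl, fun p q hpq => ?_⟩, fun p q => h3.neg, ?_, ?_⟩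
      · exact absurd ((Fin.fin_one_eq_zero p).trans (Fin.fin_one_eq_zero q).symm) hpq
      · rw [h1.1.eq_X_add_C (by simpa using h1.2)]
        simp [Matrix.charpoly]
      · rw [Polynomial.eq_one_of_monic_natDegree_zero h2.1 h2.2]
        simp [Matrix.charpoly]
  | succ N ih =>
    set B' := B.submatrix Fin.succ Fin.succ with hB'
    set B'' := B'.submatrix Fin.succ Fin.succ with hB''
    have hb := apply_zero_one_ne_zero hB
    have hrec := charpoly_jacobi hB
    rw [← hB', ← hB''] at hrec
    have hcardN : B''.charpoly.natDegree = N := by simp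
    have hcardN1 : B'.charpoly.natDegree = N + 1 := by simp
    have hlead : B''.charpoly.coeff N = 1 := by
      have := (Matrix.charpoly_monic B'').coeff_natDegree
      rwa [hcardN] at this
    have hlead' : B'.charpoly.coeff (N + 1) = 1 := by
      have := (Matrix.charpoly_monic B').coeff_natDegree
      rwa [hcardN1] at this
    -- The recurrence should read `P = (X - d) R - β S` with `S` monic of degree `N`. The
    -- coefficient of `X ^ (N + 1)` determines `d`; then `Q = β S`, and `β` is its coefficient at `X
    -- ^ N`.
    let d : E → ℝ := fun x => (R x).coeff N - (P x).coeff (N + 1)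
    let Q : E → ℝ[X] := fun x => (X - C (d x)) * R x - P x
    let β : E → ℝ := fun x => (Q x).coeff N
    have hds : ∀ᶠ x in 𝓝 x₀, ContDiffAt ℝ ∞ d x := by
      filter_upwards [hRs N, hPs (N + 1)] with x h1 h2 using h1.sub h2
    have hQs : ∀ m, ∀ᶠ x in 𝓝 x₀, ContDiffAt ℝ ∞ (fun y => (Q y).coeff m) x := by
      intro m
      cases m with
      | zero =>
        filter_upwards [hds, hRs 0, hPs 0] with x h1 h2 h3
        simp only [Q, coeff_sub, sub_mul, coeff_X_mul_zero, coeff_C_mul]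
        exact (contDiffAt_const.sub (h1.mul h2)).sub h3
      | succ m =>
        filter_upwards [hds, hRs m, hRs (m + 1), hPs (m + 1)] with x h1 h2 h3 h4
        simp only [Q, coeff_sub, sub_mul, coeff_X_mul, coeff_C_mul]
        exact (h2.sub (h1.mul h3)).sub h4
    have hd0 : d x₀ = B 0 0 := by
      simp only [d]
      rw [hP, hR, hrec, coeff_sub, sub_mul, coeff_sub, coeff_X_mul, coeff_C_mul, coeff_C_mul,
        hlead', coeff_eq_zero_of_natDegree_lt (by omega : B''.charpoly.natDegree < N + 1)]
      ring
    have hQ0 : Q x₀ = C (B 0 1 ^ 2) * B''.charpoly := by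
      simp only [Q]
      rw [hd0, hP, hR, hrec]
      ring
    have hβ0 : β x₀ = B 0 1 ^ 2 := by
      simp only [β]
      rw [hQ0, coeff_C_mul, hlead, mul_one]
    have hβs : ∀ᶠ x in 𝓝 x₀, ContDiffAt ℝ ∞ β x := hQs N
    have hβpos : ∀ᶠ x in 𝓝 x₀, 0 < β x :=
      hβs.self_of_nhds.continuousAt.eventually (lt_mem_nhds (by rw [hβ0]; positivity))
    have hQdeg : ∀ᶠ x in 𝓝 x₀, (Q x).natDegree ≤ N := by
      filter_upwards [hPm, hRm] with x h1 h2
      have h1l : (P x).coeff (N + 2) = 1 := by rw [← h1.2]; exact h1.1.coeff_natDegree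
      have h2l : (R x).coeff (N + 1) = 1 := by rw [← h2.2]; exact h2.1.coeff_natDegree
      rw [natDegree_le_iff_coeff_eq_zero]
      intro m hm
      obtain ⟨m, rfl⟩ : ∃ l, m = l + 1 := ⟨m - 1, by omega⟩
      simp only [Q, coeff_sub, sub_mul, coeff_X_mul, coeff_C_mul, d]
      rcases Nat.lt_or_ge m (N + 1) with h | h
      · obtain rfl : m = N := by omega
        rw [h2l]; ring
      · rcases Nat.lt_or_ge m (N + 2) with h' | h'
        · obtain rfl : m = N + 1 := by omega
          rw [h2l, h1l, coeff_eq_zero_of_natDegree_lt (by omega : (R x).natDegree < N + 1 + 1)]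
          ring
        · rw [coeff_eq_zero_of_natDegree_lt (by omega : (R x).natDegree < m),
            coeff_eq_zero_of_natDegree_lt (by omega : (R x).natDegree < m + 1),
            coeff_eq_zero_of_natDegree_lt (by omega : (P x).natDegree < m + 1)]
          ring
    -- The trailing block is built from `R` and `S = β⁻¹ Q`; positivity of `β` near `x₀` makes the
    -- division smooth.
    obtain ⟨J, hJ0, hJ⟩ := ih (submatrix_succ_mem hB) R (fun x => C (β x)⁻¹ * Q x) hRm
      (by
        filter_upwards [hβpos, hQdeg] with x h1 h2
        have hc : (C (β x)⁻¹ * Q x).coeff N = 1 := by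
          rw [coeff_C_mul]; exact inv_mul_cancel₀ h1.ne'
        have hle : (C (β x)⁻¹ * Q x).natDegree ≤ N := (natDegree_C_mul_le _ _).trans h2
        have heq : (C (β x)⁻¹ * Q x).natDegree = N :=
          le_antisymm hle (le_natDegree_of_ne_zero (by rw [hc]; exact one_ne_zero))
        exact ⟨by rw [Monic, leadingCoeff, heq, hc], heq⟩)
      hRs
      (fun m => by
        filter_upwards [hβpos, hβs, hQs m] with x h1 h2 h3
        simp only [coeff_C_mul]
        exact (h2.inv h1.ne').mul h3)
      hR
      (by
        rw [hQ0, hβ0, ← mul_assoc, ← C_mul, inv_mul_cancel₀ (pow_ne_zero 2 hb), C_1, one_mul])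
    have hb2 : 0 < B 0 1 ^ 2 := by positivity
    -- The recurrence gives only the square `β` of the corner edge; this is its square root with the
    -- sign of `B 0 1`, so that the family passes through `B`.
    refine ⟨fun x => jacobiCons (d x) (B 0 1 * √(β x / B 0 1 ^ 2)) (J x), ?_, ?_⟩
    · simp only
      rw [hd0, hβ0, hJ0, div_self hb2.ne', Real.sqrt_one, mul_one]
      exact jacobiCons_eq hB
    · filter_upwards [hJ, hds, hβs, hβpos] with x ⟨h1, h2, h3, h4⟩ h5 h6 h7
      have hpos : 0 < β x / B 0 1 ^ 2 := div_pos h7 hb2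
      have hmem : jacobiCons (d x) (B 0 1 * √(β x / B 0 1 ^ 2)) (J x) ∈
          MatricesWithGraph (SimpleGraph.pathGraph (N + 2)) :=
        jacobiCons_mem (mul_ne_zero hb (Real.sqrt_pos.2 hpos).ne') h1
      have hsm : ContDiffAt ℝ ∞ (fun y => B 0 1 * √(β y / B 0 1 ^ 2)) x :=
        contDiffAt_const.mul ((h6.div_const _).sqrt hpos.ne')
      refine ⟨hmem, fun p q => ?_, ?_, ?_⟩
      · refine Fin.cases ?_ (fun p => ?_) p <;> refine Fin.cases ?_ (fun q => ?_) q
        · exact h5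
        · simp only [jacobiCons_zero_succ]
          split_ifs
          · exact hsm
          · exact contDiffAt_const
        · simp only [jacobiCons_succ_zero]
          split_ifs
          · exact hsm
          · exact contDiffAt_const
        · exact h2 p q
      · have e0 : jacobiCons (d x) (B 0 1 * √(β x / B 0 1 ^ 2)) (J x) 0 0 = d x := rfl
        have e1 : jacobiCons (d x) (B 0 1 * √(β x / B 0 1 ^ 2)) (J x) 0 1 ^ 2 = β x := by
          have : jacobiCons (d x) (B 0 1 * √(β x / B 0 1 ^ 2)) (J x) 0 1
              = B 0 1 * √(β x / B 0 1 ^ 2) := by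
            rw [← Fin.succ_zero_eq_one, jacobiCons_zero_succ, if_pos rfl]
          rw [this, mul_pow, Real.sq_sqrt hpos.le]
          field_simp
        rw [charpoly_jacobi hmem, jacobiCons_submatrix, e0, e1, h3, h4, ← mul_assoc, ← C_mul,
          mul_inv_cancel₀ h7.ne', C_1, one_mul]
        simp only [Q]
        ring
      · rw [jacobiCons_submatrix, h3]

theorem contDiff_coeff_prod {E ι : Type*} [NormedAddCommGroup E] [NormedSpace ℝ E]
    (s : Finset ι) (f : ι → E → ℝ) (hf : ∀ i, ContDiff ℝ ∞ (f i)) (m : ℕ) :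
    ContDiff ℝ ∞ fun x => (∏ i ∈ s, (X - C (f i x))).coeff m := by
  classical
  induction s using Finset.induction_on generalizing m with
  | empty => simpa using contDiff_const
  | insert i s hi ih =>
    simp only [Finset.prod_insert hi, sub_mul, coeff_sub, coeff_C_mul]
    refine ContDiff.sub ?_ ((hf i).mul (ih m))
    cases m with
    | zero => simpa using contDiff_const
    | succ m => simpa only [coeff_X_mul] using ih m

theorem charpoly_submatrix_val_ne_zero {N : ℕ} (B : Matrix (Fin (N + 1)) (Fin (N + 1)) ℝ) :
    (B.submatrix (Subtype.val : {p : Fin (N + 1) // p.val ≠ 0} → _) Subtype.val).charpoly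
      = (B.submatrix Fin.succ Fin.succ).charpoly := by
  let e : Fin N ≃ {p : Fin (N + 1) // p.val ≠ 0} :=
    { toFun := fun p => ⟨p.succ, by simp⟩
      invFun := fun p => p.1.pred fun h => p.2 (by simp [h])
      left_inv := fun p => by simp
      right_inv := fun p => by simp }
  rw [← Matrix.charpoly_reindex e.symm]
  rfl

/-- A Jacobi matrix depends smoothly on its eigenvalues and on those of its trailing principal
submatrix. -/
theorem exists_jacobi_family_of_eigenvalues {E : Type*} [NormedAddCommGroup E] [NormedSpace ℝ E]
    (x₀ : E) {N : ℕ} (hN : 0 < N) {B : Matrix (Fin N) (Fin N) ℝ}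
    (hB : B ∈ MatricesWithGraph (SimpleGraph.pathGraph N))
    (γ : Fin N → E → ℝ) (hγ : ∀ j, ContDiff ℝ ∞ (γ j))
    (η : Fin (N - 1) → E → ℝ) (hη : ∀ j, ContDiff ℝ ∞ (η j))
    (hP : B.charpoly = ∏ j, (X - C (γ j x₀)))
    (hR : (B.submatrix (Subtype.val : {p : Fin N // p.val ≠ 0} → _) Subtype.val).charpoly
      = ∏ j, (X - C (η j x₀))) :
    ∃ J : E → Matrix (Fin N) (Fin N) ℝ, J x₀ = B ∧ ∀ᶠ x in 𝓝 x₀,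
      J x ∈ MatricesWithGraph (SimpleGraph.pathGraph N) ∧
      (∀ p q, ContDiffAt ℝ ∞ (fun y => J y p q) x) ∧
      (J x).charpoly = ∏ j, (X - C (γ j x)) ∧
      ((J x).submatrix (Subtype.val : {p : Fin N // p.val ≠ 0} → _) Subtype.val).charpoly
        = ∏ j, (X - C (η j x)) := by
  obtain ⟨N, rfl⟩ : ∃ K, N = K + 1 := ⟨N - 1, by omega⟩
  simp only [charpoly_submatrix_val_ne_zero] at hR ⊢
  refine exists_jacobi_family x₀ hB (fun x => ∏ j, (X - C (γ j x))) (fun x => ∏ j, (X - C (η j x)))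
    (Eventually.of_forall fun x => ⟨monic_prod_X_sub_C _ _, by simp⟩)
    (Eventually.of_forall fun x => ⟨monic_prod_X_sub_C _ _, by simp⟩)
    (fun m => Eventually.of_forall fun x => (contDiff_coeff_prod _ γ hγ m).contDiffAt)
    (fun m => Eventually.of_forall fun x => (contDiff_coeff_prod _ η hη m).contDiffAt)
    hP.symm hR.symm

/-! ### Block structure of the star and its secular equation. -/

theorem det_blockDiagonal' {o R : Type*} [Fintype o] [LinearOrder o] [CommRing R] {m : o → Type*}
    [∀ i, Fintype (m i)] [∀ i, DecidableEq (m i)] (D : ∀ i, Matrix (m i) (m i) R) :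
    (Matrix.blockDiagonal' D).det = ∏ i, (D i).det := by
  rw [(Matrix.blockTriangular_blockDiagonal' D).det_fintype]
  refine Finset.prod_congr rfl fun i _ => ?_
  rw [← Matrix.det_submatrix_equiv_self (Equiv.sigmaSubtype i).symm]
  congr 1
  ext p q
  exact Matrix.blockDiagonal'_apply_eq D i p q

theorem apply_some_some_of_ne {k : ℕ} {n : Fin k → ℕ} {A : Matrix (Vertex n) (Vertex n) ℝ}
    (hA : A ∈ MatricesWithGraph (starGraph n)) {a b : Σ i, Fin (n i)} (h : a.1 ≠ b.1) :
    A (some a) (some b) = 0 := by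
  by_contra hne
  have := (hA.2 (some a) (some b) fun h' => h (by rw [Option.some.inj h'])).1 hne
  simp [starGraph, edgeRel, h, h.symm] at this

theorem apply_none_some_of_ne {k : ℕ} {n : Fin k → ℕ} {A : Matrix (Vertex n) (Vertex n) ℝ}
    (hA : A ∈ MatricesWithGraph (starGraph n)) {a : Σ i, Fin (n i)} (h : a.2.val ≠ 0) :
    A none (some a) = 0 := by
  by_contra hne
  have := (hA.2 none (some a) (by simp)).1 hne
  simp only [starGraph, SimpleGraph.fromRel_adj, edgeRel] at this
  tauto

theorem apply_none_some_ne_zero {k : ℕ} {n : Fin k → ℕ} {A : Matrix (Vertex n) (Vertex n) ℝ}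
    (hA : A ∈ MatricesWithGraph (starGraph n)) {a : Σ i, Fin (n i)} (h : a.2.val = 0) :
    A none (some a) ≠ 0 := by
  rw [hA.2 none (some a) (by simp)]
  simp [starGraph, edgeRel, h]

theorem arm_mem {k : ℕ} {n : Fin k → ℕ} {A : Matrix (Vertex n) (Vertex n) ℝ}
    (hA : A ∈ MatricesWithGraph (starGraph n)) (i : Fin k) :
    arm A i ∈ MatricesWithGraph (SimpleGraph.pathGraph (n i)) := by
  refine ⟨hA.1.submatrix _, fun p q hpq => ?_⟩
  have hne : (some ⟨i, p⟩ : Vertex n) ≠ some ⟨i, q⟩ := by simpa using hpq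
  rw [arm, Matrix.submatrix_apply, hA.2 _ _ hne, SimpleGraph.pathGraph_adj]
  simp [starGraph, edgeRel, hpq]
  omega

theorem submatrix_some_eq {k : ℕ} {n : Fin k → ℕ} {A : Matrix (Vertex n) (Vertex n) ℝ}
    (hA : A ∈ MatricesWithGraph (starGraph n)) :
    A.submatrix some some = Matrix.blockDiagonal' (arm A) := by
  ext ⟨i, p⟩ ⟨j, q⟩
  by_cases h : i = j
  · subst h
    rw [Matrix.blockDiagonal'_apply_eq]
    rfl
  · rw [Matrix.blockDiagonal'_apply_ne _ _ _ h]
    exact apply_some_some_of_ne hA h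

theorem charpoly_deleteVertex {k : ℕ} {n : Fin k → ℕ} {A : Matrix (Vertex n) (Vertex n) ℝ}
    (hA : A ∈ MatricesWithGraph (starGraph n)) :
    (deleteVertex A none).charpoly = ∏ i, (arm A i).charpoly := by
  let e : (Σ i, Fin (n i)) ≃ {w : Vertex n // w ≠ none} :=
    { toFun := fun a => ⟨some a, by simp⟩
      invFun := fun w => w.1.get (Option.isSome_iff_ne_none.2 w.2)
      left_inv := fun a => by simp
      right_inv := fun w => by simp }
  have h1 : (deleteVertex A none).charpoly = (A.submatrix some some).charpoly := by
    rw [← Matrix.charpoly_reindex e.symm]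
    rfl
  rw [h1, submatrix_some_eq hA]
  simp only [Matrix.charpoly]
  rw [← det_blockDiagonal']
  congr 1
  ext ⟨i, p⟩ ⟨j, q⟩ : 2
  by_cases h : i = j
  · subst h
    by_cases h2 : p = q
    · subst h2; simp [Matrix.blockDiagonal'_apply_eq]
    · have h3 : (⟨i, p⟩ : Σ i, Fin (n i)) ≠ ⟨i, q⟩ := by simpa using h2
      rw [Matrix.blockDiagonal'_apply_eq, Matrix.charmatrix_apply_ne _ _ _ h3,
        Matrix.charmatrix_apply_ne _ _ _ h2, Matrix.blockDiagonal'_apply_eq]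
  · have h3 : (⟨i, p⟩ : Σ i, Fin (n i)) ≠ ⟨j, q⟩ := by
      intro h'; exact h (congrArg Sigma.fst h')
    rw [Matrix.blockDiagonal'_apply_ne _ _ _ h, Matrix.charmatrix_apply_ne _ _ _ h3,
      Matrix.blockDiagonal'_apply_ne _ _ _ h]
    simp

/-- Cramer's rule for the corner entry of the resolvent. -/
theorem inv_scalar_sub_apply_zero {N : ℕ} (hN : 0 < N) (B : Matrix (Fin N) (Fin N) ℝ) (t : ℝ) :
    (Matrix.scalar (Fin N) t - B)⁻¹ ⟨0, hN⟩ ⟨0, hN⟩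
      = (B.submatrix (Subtype.val : {p : Fin N // p.val ≠ 0} → _) Subtype.val).charpoly.eval t
        / B.charpoly.eval t := by
  obtain ⟨N, rfl⟩ : ∃ K, N = K + 1 := ⟨N - 1, by omega⟩
  have h0 : (⟨0, hN⟩ : Fin (N + 1)) = 0 := rfl
  rw [charpoly_submatrix_val_ne_zero, h0, Matrix.inv_def, Matrix.smul_apply,
    Matrix.adjugate_fin_succ_eq_det_submatrix, Matrix.eval_charpoly, Matrix.eval_charpoly,
    Ring.inverse_eq_inv', smul_eq_mul, div_eq_inv_mul]
  congr 1
  have : (Matrix.scalar (Fin (N + 1)) t - B).submatrix (Fin.succAbove 0) (Fin.succAbove 0)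
      = Matrix.scalar (Fin N) t - B.submatrix Fin.succ Fin.succ := by
    ext p q
    simp [Matrix.diagonal_apply]
  rw [this]
  simp

/-- The secular equation of a generalized star. -/
theorem eval_charpoly_star {k : ℕ} {n : Fin k → ℕ} (hn : ∀ i, 0 < n i)
    {A : Matrix (Vertex n) (Vertex n) ℝ} (hA : A ∈ MatricesWithGraph (starGraph n)) {t : ℝ}
    (ht : ∀ i, (arm A i).charpoly.eval t ≠ 0) :
    A.charpoly.eval t = (∏ i, (arm A i).charpoly.eval t) *
      (t - A none none - ∑ i, A none (some ⟨i, ⟨0, hn i⟩⟩) ^ 2 *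
        ((armTail A i).charpoly.eval t / (arm A i).charpoly.eval t)) := by
  let D : Matrix (Σ i, Fin (n i)) (Σ i, Fin (n i)) ℝ :=
    Matrix.blockDiagonal' fun i => Matrix.scalar (Fin (n i)) t - arm A i
  let G : Matrix (Σ i, Fin (n i)) (Σ i, Fin (n i)) ℝ :=
    Matrix.blockDiagonal' fun i => (Matrix.scalar (Fin (n i)) t - arm A i)⁻¹
  have hGD : G * D = 1 := by
    rw [← Matrix.blockDiagonal'_mul, ← Matrix.blockDiagonal'_one]
    congr 1
    funext i
    refine Matrix.nonsing_inv_mul _ ?_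
    rw [← Matrix.eval_charpoly]
    exact (ht i).isUnit
  have hdet : D.det = ∏ i, (arm A i).charpoly.eval t := by
    simp only [D, det_blockDiagonal', Matrix.eval_charpoly]
  let _ : Invertible D := invertibleOfLeftInverse D G hGD
  let c : (Σ i, Fin (n i)) → ℝ := fun a => A none (some a)
  have hc : ∀ i p, p ≠ ⟨0, hn i⟩ → c ⟨i, p⟩ = 0 := fun i p hp =>
    apply_none_some_of_ne hA (by simpa [Fin.ext_iff] using hp)
  have key : (Matrix.scalar (Vertex n) t - A).submatrix (Equiv.optionEquivSumPUnit _).symm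
      (Equiv.optionEquivSumPUnit _).symm
      = Matrix.fromBlocks D (Matrix.of fun a (_ : PUnit.{1}) => -c a)
        (Matrix.of fun (_ : PUnit.{1}) a => -c a)
        (Matrix.of fun _ _ => t - A none none) := by
    have hD : D = Matrix.scalar _ t - A.submatrix some some := by
      rw [submatrix_some_eq hA]
      have h1 : (Matrix.scalar (Σ i, Fin (n i)) t)
          = Matrix.blockDiagonal' fun i => Matrix.scalar (Fin (n i)) t := by
        simp only [Matrix.scalar_apply]
        exact (Matrix.blockDiagonal'_diagonal fun i (_ : Fin (n i)) => t).symm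
      rw [h1, ← Matrix.blockDiagonal'_sub]
      rfl
    ext (a | a) (b | b)
    · rw [hD]
      simp [Matrix.diagonal_apply]
    · simp [c, hA.1.apply]
    · simp [c]
    · simp
  -- Schur complement of the block of all arms, with the centre put last. Only the first vertex of
  -- each arm meets the centre, so only the corner entry of each resolvent survives.
  rw [Matrix.eval_charpoly, ← Matrix.det_submatrix_equiv_self (Equiv.optionEquivSumPUnit _).symm,
    key, Matrix.det_fromBlocks₁₁, hdet]
  congr 1
  rw [Matrix.det_unique]
  have hG : (⅟D : Matrix _ _ ℝ) = G := rfl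
  rw [hG, Matrix.sub_apply, Matrix.of_apply]
  congr 1
  rw [Matrix.mul_apply, Fintype.sum_sigma]
  refine Finset.sum_congr rfl fun i _ => ?_
  rw [Finset.sum_eq_single ⟨0, hn i⟩ (fun p _ hp => by simp [hc i p hp]) (by simp),
    Matrix.mul_apply, Fintype.sum_sigma, Finset.sum_eq_single i, Finset.sum_eq_single ⟨0, hn i⟩]
  · simp only [Matrix.of_apply, G, Matrix.blockDiagonal'_apply_eq, c]
    rw [inv_scalar_sub_apply_zero, armTail]
    ring
  · intro p _ hp
    simp [hc i p hp]
  · simp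
  · intro j _ hj
    refine Finset.sum_eq_zero fun p _ => ?_
    simp only [G, Matrix.blockDiagonal'_apply_ne _ _ _ hj, mul_zero]
  · simp

/-- The secular equation with denominators cleared: the two polynomials agree off the finitely many
roots of `∏ i, (arm A i).charpoly`, hence everywhere. This form remains usable at the eigenvalues of
the arms. -/
theorem charpoly_star {k : ℕ} {n : Fin k → ℕ} (hn : ∀ i, 0 < n i)
    {A : Matrix (Vertex n) (Vertex n) ℝ} (hA : A ∈ MatricesWithGraph (starGraph n)) :
    A.charpoly = (X - C (A none none)) * ∏ i, (arm A i).charpoly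
      - ∑ i, C (A none (some ⟨i, ⟨0, hn i⟩⟩) ^ 2) * (armTail A i).charpoly *
        ∏ j ∈ Finset.univ.erase i, (arm A j).charpoly := by
  have hne : (∏ i, (arm A i).charpoly) ≠ 0 :=
    Finset.prod_ne_zero_iff.2 fun i _ => (Matrix.charpoly_monic _).ne_zero
  refine eq_of_infinite_eval_eq _ _
    ((Polynomial.finite_setOfPred_isRoot hne).infinite_compl.mono ?_)
  intro t ht
  have ht' : ∀ i, (arm A i).charpoly.eval t ≠ 0 := by
    intro i hi
    refine ht ?_
    simp only [Set.mem_ofPred_eq, IsRoot, eval_prod]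
    exact Finset.prod_eq_zero (Finset.mem_univ i) hi
  simp only [Set.mem_ofPred_eq]
  rw [eval_charpoly_star hn hA ht']
  simp only [eval_sub, eval_mul, eval_X, eval_C, eval_prod, eval_finsetSum]
  rw [mul_sub, mul_comm, Finset.mul_sum]
  congr 1
  refine Finset.sum_congr rfl fun i _ => ?_
  rw [← Finset.mul_prod_erase _ _ (Finset.mem_univ i)]
  have := ht' i
  field_simp

/-! ### Upward eigenvalues are the eigenvalues of the arms. -/

theorem wronskian_arm_pos {k : ℕ} {n : Fin k → ℕ} (hn : ∀ i, 0 < n i)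
    (A : Matrix (Vertex n) (Vertex n) ℝ) (i : Fin k) (x : ℝ)
    (hA : A ∈ MatricesWithGraph (starGraph n)) :
    0 < (arm A i).charpoly.derivative.eval x * (armTail A i).charpoly.eval x
      - (arm A i).charpoly.eval x * (armTail A i).charpoly.derivative.eval x := by
  -- A variable length is needed here, since `n i` cannot be replaced by a successor.
  have key : ∀ {N : ℕ} (_ : 0 < N) {B : Matrix (Fin N) (Fin N) ℝ}
      (_ : B ∈ MatricesWithGraph (SimpleGraph.pathGraph N)),
      0 < B.charpoly.derivative.eval x *
          (B.submatrix (Subtype.val : {p : Fin N // p.val ≠ 0} → _) Subtype.val).charpoly.eval x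
        - B.charpoly.eval x *
          (B.submatrix (Subtype.val : {p : Fin N // p.val ≠ 0} → _)
            Subtype.val).charpoly.derivative.eval x := by
    intro N hN B hB
    obtain ⟨N, rfl⟩ : ∃ K, N = K + 1 := ⟨N - 1, by omega⟩
    rw [charpoly_submatrix_val_ne_zero]
    exact wronskian_jacobi_pos hB x
  exact key (hn i) (arm_mem hA i)

/-- The factorization of the characteristic polynomial of an arm at `x`: a root is simple, and
there the residue of the resolvent is positive. -/
theorem exists_charpoly_arm_eq {k : ℕ} {n : Fin k → ℕ} (hn : ∀ i, 0 < n i)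
    {A : Matrix (Vertex n) (Vertex n) ℝ} (hA : A ∈ MatricesWithGraph (starGraph n)) (x : ℝ)
    (i : Fin k) : ∃ (e : ℕ) (p : ℝ[X]), e ≤ 1 ∧ (arm A i).charpoly = (X - C x) ^ e * p ∧
      p.eval x ≠ 0 ∧ (e = 1 → 0 < (armTail A i).charpoly.eval x * p.eval x) := by
  by_cases h : (arm A i).charpoly.eval x = 0
  · obtain ⟨p, hp⟩ := dvd_iff_isRoot.2 h
    have hw := wronskian_arm_pos hn A i x hA
    have hpos : 0 < (armTail A i).charpoly.eval x * p.eval x := by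
      rw [hp] at hw
      simpa [mul_comm] using hw
    exact ⟨1, p, le_rfl, by rw [pow_one, hp], right_ne_zero_of_mul hpos.ne', fun _ => hpos⟩
  · exact ⟨0, _, zero_le_one, by rw [pow_zero, one_mul], h, fun h => absurd h zero_ne_one⟩

/-- If `x` is a root of `r + 1 ≥ 1` arms, it has multiplicity `r + 1` in `A(v)`. In `charpoly_star`
every term is divisible by `(X - C x) ^ r`, and after division the terms that do not vanish at `x`
come from the arms with root `x`; positive residues give them a common sign, so the multiplicity in
`A` is exactly `r`. -/
theorem isUpward_iff_exists_arm {k : ℕ} {n : Fin k → ℕ} (hn : ∀ i, 0 < n i)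
    {A : Matrix (Vertex n) (Vertex n) ℝ} (hA : A ∈ MatricesWithGraph (starGraph n)) (x : ℝ) :
    IsUpward A none x ↔ ∃ i, (arm A i).charpoly.eval x = 0 := by
  rw [IsUpward, mult, mult, charpoly_deleteVertex hA]
  have hne : (∏ i, (arm A i).charpoly) ≠ 0 :=
    Finset.prod_ne_zero_iff.2 fun i _ => (Matrix.charpoly_monic _).ne_zero
  constructor
  · intro h
    have h0 : 0 < (∏ i, (arm A i).charpoly).rootMultiplicity x := by omega
    have h1 := (rootMultiplicity_pos hne).1 h0
    rw [IsRoot, eval_prod, Finset.prod_eq_zero_iff] at h1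
    obtain ⟨i, _, hi⟩ := h1
    exact ⟨i, hi⟩
  · rintro ⟨i₀, hi₀⟩
    choose e p he hep hp hpos using exists_charpoly_arm_eq hn hA x
    have he₀ : e i₀ = 1 := by
      by_contra hne'
      have : e i₀ = 0 := by have := he i₀; omega
      rw [hep, this, pow_zero, one_mul] at hi₀
      exact hp i₀ hi₀
    have hm : ∀ (r : ℕ) (G : ℝ[X]), G.eval x ≠ 0 →
        ((X - C x) ^ r * G).rootMultiplicity x = r := by
      intro r G hG
      rw [mul_comm, rootMultiplicity_mul_X_sub_C_pow (by rintro rfl; simp at hG),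
        rootMultiplicity_eq_zero hG, zero_add]
    obtain ⟨r, hr⟩ : ∃ r, ∑ i, e i = r + 1 := by
      have := Finset.single_le_sum (f := e) (fun i _ => Nat.zero_le _) (Finset.mem_univ i₀)
      exact ⟨∑ i, e i - 1, by omega⟩
    have hprod : ∏ i, (arm A i).charpoly = (X - C x) ^ (r + 1) * ∏ i, p i := by
      simp only [hep, Finset.prod_mul_distrib, Finset.prod_pow_eq_pow_sum, hr]
    have herase : ∀ i, ∏ j ∈ Finset.univ.erase i, (arm A j).charpoly
        = (X - C x) ^ r * ((X - C x) ^ (1 - e i) * ∏ j ∈ Finset.univ.erase i, p j) := by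
      intro i
      simp only [hep, Finset.prod_mul_distrib, Finset.prod_pow_eq_pow_sum]
      have : ∑ j ∈ Finset.univ.erase i, e j = r + (1 - e i) := by
        have h1 := Finset.add_sum_erase _ e (Finset.mem_univ i)
        have h2 := he i
        omega
      rw [this, pow_add, mul_assoc]
    have hprodx : (∏ i, p i).eval x ≠ 0 := by
      rw [eval_prod]
      exact Finset.prod_ne_zero_iff.2 fun i _ => hp i
    set w : Fin k → ℝ := fun i => A none (some ⟨i, ⟨0, hn i⟩⟩) with hw
    have hw0 : ∀ i, w i ≠ 0 := fun i => apply_none_some_ne_zero hA rfl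
    have hA' : A.charpoly = (X - C x) ^ r * ((X - C x) * ((X - C (A none none)) * ∏ i, p i)
        - ∑ i, C (w i ^ 2) * (armTail A i).charpoly *
          ((X - C x) ^ (1 - e i) * ∏ j ∈ Finset.univ.erase i, p j)) := by
      rw [charpoly_star hn hA, hprod, mul_sub, Finset.mul_sum]
      congr 1
      · ring
      · refine Finset.sum_congr rfl fun i _ => ?_
        rw [herase]
        ring
    -- Multiplying by `∏ p_i(x)` completes the squares and exposes the signs; the factor `0 ^ (1 - e
    -- i)` is `1` on arms with root `x` and `0` on the others.
    have hG : (∏ i, p i).eval x * (∑ i, C (w i ^ 2) * (armTail A i).charpoly *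
          ((X - C x) ^ (1 - e i) * ∏ j ∈ Finset.univ.erase i, p j)).eval x
        = ∑ i, w i ^ 2 * ((armTail A i).charpoly.eval x * (p i).eval x) *
          (0 ^ (1 - e i) * (∏ j ∈ Finset.univ.erase i, (p j).eval x) ^ 2) := by
      rw [eval_finsetSum, Finset.mul_sum]
      refine Finset.sum_congr rfl fun i _ => ?_
      rw [← Finset.mul_prod_erase _ _ (Finset.mem_univ i)]
      simp only [eval_mul, eval_prod, eval_pow, eval_sub, eval_X, eval_C, sub_self]
      ring
    have hterm : ∀ i, e i = 1 → 0 < w i ^ 2 * ((armTail A i).charpoly.eval x * (p i).eval x) *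
          (0 ^ (1 - e i) * (∏ j ∈ Finset.univ.erase i, (p j).eval x) ^ 2) := by
      intro i hi
      have h1 := hpos i hi
      have h2 := hw0 i
      have h3 : ∏ j ∈ Finset.univ.erase i, (p j).eval x ≠ 0 :=
        Finset.prod_ne_zero_iff.2 fun j _ => hp j
      simp only [hi, Nat.sub_self, pow_zero, one_mul]
      positivity
    have hsum : 0 < ∑ i, w i ^ 2 * ((armTail A i).charpoly.eval x * (p i).eval x) *
          (0 ^ (1 - e i) * (∏ j ∈ Finset.univ.erase i, (p j).eval x) ^ 2) := by
      refine Finset.sum_pos' (fun i _ => ?_) ⟨i₀, Finset.mem_univ _, hterm i₀ he₀⟩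
      rcases Nat.le_one_iff_eq_zero_or_eq_one.1 (he i) with h | h
      · simp [h]
      · exact (hterm i h).le
    rw [hprod, hA', hm _ _ hprodx, hm]
    rw [← hG] at hsum
    simpa using right_ne_zero_of_mul hsum.ne'

/-! ### Simple fractions and partial fraction expansions. -/

/-- The values at the points `lam l` of the constant `1` and of the simple fractions with poles
`μ j`. -/
noncomputable def simpleFraction {u : ℕ} (μ : Fin u → ℝ) (lam : Fin (u + 1) → ℝ) :
    Option (Fin u) → Fin (u + 1) → ℝ
  | none => 1
  | some j => fun l => (lam l - μ j)⁻¹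

/-- Clearing denominators turns a relation into a polynomial of degree at most `u` with `u + 1`
roots, hence zero; its value at `μ j` isolates the coefficient of that pole. -/
theorem linearIndependent_simpleFraction {u : ℕ} {μ : Fin u → ℝ} {lam : Fin (u + 1) → ℝ}
    (hμ : Function.Injective μ) (hlam : Function.Injective lam) (h : ∀ l j, lam l ≠ μ j) :
    LinearIndependent ℝ (simpleFraction μ lam) := by
  rw [Fintype.linearIndependent_iff]
  intro g hg
  let f : ℝ[X] := C (g none) * ∏ j, (X - C (μ j))
    + ∑ j, C (g (some j)) * ∏ m ∈ Finset.univ.erase j, (X - C (μ m))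
  have hdeg : f.natDegree < u + 1 := by
    refine Nat.lt_succ_of_le (natDegree_add_le_of_degree_le ?_ (natDegree_sum_le_of_forall_le _ _
      fun j _ => ?_))
    · refine (natDegree_C_mul_le _ _).trans ?_
      rw [natDegree_finsetProd_X_sub_C_eq_card]
      simp
    · refine (natDegree_C_mul_le _ _).trans ?_
      rw [natDegree_finsetProd_X_sub_C_eq_card]
      exact (Finset.card_le_univ _).trans (by simp)
  have hev : ∀ l, f.eval (lam l) = 0 := by
    intro l
    have hl := congrFun hg l
    simp only [Fintype.sum_option, simpleFraction, Pi.smul_apply, Pi.one_apply,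
      Finset.sum_apply, smul_eq_mul, mul_one, Pi.zero_apply] at hl
    have : f.eval (lam l) = (∏ j, (lam l - μ j)) *
        (g none + ∑ j, g (some j) * (lam l - μ j)⁻¹) := by
      simp only [f, eval_add, eval_mul, eval_C, eval_prod, eval_sub, eval_X, eval_finsetSum]
      rw [mul_add, mul_comm, Finset.mul_sum]
      congr 1
      refine Finset.sum_congr rfl fun j _ => ?_
      rw [← Finset.mul_prod_erase _ _ (Finset.mem_univ j)]
      have := sub_ne_zero.2 (h l j)
      field_simp
    rw [this, hl, mul_zero]
  have hf : f = 0 := Polynomial.eq_zero_of_natDegree_lt_card_of_eval_eq_zero f hlam hev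
    (by simpa using hdeg)
  have hsome : ∀ j, g (some j) = 0 := by
    intro j
    have h1 : f.eval (μ j) = 0 := by rw [hf, eval_zero]
    simp only [f, eval_add, eval_mul, eval_C, eval_prod, eval_sub, eval_X, eval_finsetSum] at h1
    rw [Finset.prod_eq_zero (Finset.mem_univ j) (sub_self _), mul_zero, zero_add,
      Finset.sum_eq_single j (fun i _ hi => by
        rw [Finset.prod_eq_zero (Finset.mem_erase.2 ⟨hi.symm, Finset.mem_univ j⟩) (sub_self _),
          mul_zero]) (by simp)] at h1
    refine (mul_eq_zero.1 h1).resolve_right (Finset.prod_ne_zero_iff.2 fun i hi => ?_)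
    exact sub_ne_zero.2 (hμ.ne (Finset.ne_of_mem_erase hi).symm)
  rintro (_ | j)
  · have h1 := hf
    simp only [f, hsome, C_0, zero_mul, Finset.sum_const_zero, add_zero] at h1
    rcases mul_eq_zero.1 h1 with h2 | h2
    · exact C_eq_zero.1 h2
    · exact absurd h2 (monic_prod_X_sub_C _ _).ne_zero
  · exact hsome j

/-- Partial fractions with simple poles. -/
theorem eval_div_prod_eq_sum {N : ℕ} {γ : Fin N → ℝ} (hγ : Function.Injective γ) {Q : ℝ[X]}
    (hQ : Q.degree < N) {t : ℝ} (ht : ∀ j, t ≠ γ j) :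
    Q.eval t / ∏ j, (t - γ j)
      = ∑ j, (Lagrange.nodalWeight Finset.univ γ j * Q.eval (γ j)) * (t - γ j)⁻¹ := by
  have h1 := Lagrange.eq_interpolate (s := Finset.univ) (v := γ) hγ.injOn (f := Q) (by simpa)
  have hne : ∏ j, (t - γ j) ≠ 0 := Finset.prod_ne_zero_iff.2 fun j _ => sub_ne_zero.2 (ht j)
  rw [div_eq_iff hne, h1, Lagrange.eval_interpolate_not_at_node _ fun j _ => ht j,
    Lagrange.eval_nodal, mul_comm, ← h1]
  congr 1
  exact Finset.sum_congr rfl fun j _ => by ring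

/-- Without common roots no pole cancels. The nonvanishing of every `c j` is what later forces all
poles of an arm into a span that contains its edge vector. -/
theorem exists_edge_partialFraction {N : ℕ} {γ : Fin N → ℝ} (hγ : Function.Injective γ)
    {η : Fin (N - 1) → ℝ} (hN : 0 < N) (hne : ∀ i j, γ i ≠ η j) :
    ∃ c : Fin N → ℝ, (∀ j, c j ≠ 0) ∧ ∀ t, (∀ j, t ≠ γ j) →
      (∏ j, (t - η j)) / ∏ j, (t - γ j) = ∑ j, c j * (t - γ j)⁻¹ := by
  let Q : ℝ[X] := ∏ j, (X - C (η j))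
  have hQ : Q.degree < N := by
    refine lt_of_le_of_lt degree_le_natDegree ?_
    rw [natDegree_finsetProd_X_sub_C_eq_card]
    simpa using hN
  have hev : ∀ t, Q.eval t = ∏ j, (t - η j) := fun t => by simp [Q, eval_prod]
  refine ⟨fun j => Lagrange.nodalWeight Finset.univ γ j * Q.eval (γ j), fun j => ?_, fun t ht => ?_⟩
  · refine mul_ne_zero (Lagrange.nodalWeight_ne_zero hγ.injOn (Finset.mem_univ j)) ?_
    rw [hev]
    exact Finset.prod_ne_zero_iff.2 fun i _ => sub_ne_zero.2 (hne j i)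
  · rw [← hev, eval_div_prod_eq_sum hγ hQ ht]

theorem exists_tail_partialFraction {N : ℕ} {γ : Fin N → ℝ} (hγ : Function.Injective γ)
    (η : Fin (N - 1) → ℝ) (i : Fin (N - 1)) :
    ∃ c : Fin N → ℝ, ∀ t, (∀ j, t ≠ γ j) →
      (∏ j ∈ Finset.univ.erase i, (t - η j)) / ∏ j, (t - γ j) = ∑ j, c j * (t - γ j)⁻¹ := by
  let Q : ℝ[X] := ∏ j ∈ Finset.univ.erase i, (X - C (η j))
  have hQ : Q.degree < N := by
    refine lt_of_le_of_lt degree_le_natDegree ?_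
    rw [natDegree_finsetProd_X_sub_C_eq_card, Finset.card_erase_of_mem (Finset.mem_univ i),
      Finset.card_univ, Fintype.card_fin]
    have := i.isLt
    exact_mod_cast (by omega : N - 1 - 1 < N)
  refine ⟨fun j => Lagrange.nodalWeight Finset.univ γ j * Q.eval (γ j), fun t ht => ?_⟩
  rw [← eval_div_prod_eq_sum hγ hQ ht]
  simp [Q, eval_prod]

/-- Over the denominator `∏ j, (t - γ j)` the numerators of the simple fraction and of the edge
quotient are both monic of degree `N - 1`. Their difference has smaller degree, so Lagrange
interpolation at the `N - 1` nodes `η` expresses it through the tail numerators. -/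
theorem exists_simpleFraction_eq {N : ℕ} {γ : Fin N → ℝ} {η : Fin (N - 1) → ℝ}
    (hη : Function.Injective η) (i : Fin N) :
    ∃ d : Fin (N - 1) → ℝ, ∀ t, (∀ j, t ≠ γ j) →
      (t - γ i)⁻¹ = (∏ j, (t - η j)) / ∏ j, (t - γ j)
        + ∑ j, d j * ((∏ m ∈ Finset.univ.erase j, (t - η m)) / ∏ j, (t - γ j)) := by
  let Q : ℝ[X] := ∏ j ∈ Finset.univ.erase i, (X - C (γ j))
  let R : ℝ[X] := ∏ j, (X - C (η j))
  have hQd : Q.natDegree = N - 1 := by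
    rw [natDegree_finsetProd_X_sub_C_eq_card, Finset.card_erase_of_mem (Finset.mem_univ i),
      Finset.card_univ, Fintype.card_fin]
  have hRd : R.natDegree = N - 1 := by
    rw [natDegree_finsetProd_X_sub_C_eq_card, Finset.card_univ, Fintype.card_fin]
  have hQm : Q.Monic := monic_prod_X_sub_C _ _
  have hRm : R.Monic := monic_prod_X_sub_C _ _
  have hdeg : (Q - R).degree < (Finset.univ : Finset (Fin (N - 1))).card := by
    have : Q.degree = R.degree := by
      rw [degree_eq_natDegree hQm.ne_zero, degree_eq_natDegree hRm.ne_zero, hQd, hRd]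
    refine (degree_sub_lt_left this hQm.ne_zero (by rw [hQm, hRm])).trans_le ?_
    rw [degree_eq_natDegree hQm.ne_zero, hQd]
    simp
  have hint := Lagrange.eq_interpolate (v := η) hη.injOn hdeg
  refine ⟨fun j => Lagrange.nodalWeight Finset.univ η j * (Q - R).eval (η j), fun t ht => ?_⟩
  have hne : ∏ j, (t - γ j) ≠ 0 := Finset.prod_ne_zero_iff.2 fun j _ => sub_ne_zero.2 (ht j)
  have hb : ∀ j, (Lagrange.basis Finset.univ η j).eval t
      = Lagrange.nodalWeight Finset.univ η j * ∏ m ∈ Finset.univ.erase j, (t - η m) := by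
    intro j
    simp only [Lagrange.basis, Lagrange.basisDivisor, Lagrange.nodalWeight, eval_prod, eval_mul,
      eval_C, eval_sub, eval_X, Finset.prod_mul_distrib]
  have hev := congrArg (eval t) hint
  simp only [Lagrange.interpolate_apply, eval_finsetSum, eval_mul, eval_C, hb] at hev
  rw [eval_sub] at hev
  have hQt : Q.eval t = ∏ j ∈ Finset.univ.erase i, (t - γ j) := by simp [Q, eval_prod]
  have hRt : R.eval t = ∏ j, (t - η j) := by simp [R, eval_prod]
  have hl : (t - γ i)⁻¹ = Q.eval t / ∏ j, (t - γ j) := by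
    rw [hQt, ← Finset.mul_prod_erase _ _ (Finset.mem_univ i)]
    rw [← Finset.mul_prod_erase _ _ (Finset.mem_univ i)] at hne
    have h1 := left_ne_zero_of_mul hne
    have h2 := right_ne_zero_of_mul hne
    field_simp
  rw [hl, ← sub_eq_iff_eq_add', ← hRt, ← sub_div, hev, Finset.sum_div]
  exact Finset.sum_congr rfl fun j _ => by ring

/-! ### Selecting a basis arm by arm. -/

/-- Selection of variables: a greedy choice, arm by arm, of a basis among the vectors `G`. -/
theorem exists_linearIndepOn_selection {k u : ℕ} {n : Fin k → ℕ} {V : Type*} [AddCommGroup V]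
    [Module ℝ V] (b : Module.Basis (Option (Fin u)) ℝ V) (G : Var n → V)
    (κ : ∀ i, Fin (n i) → Fin u) (hκ : ∀ i, Function.Injective (κ i))
    (hκs : ∀ m, ∃ i j, κ i j = m) (c₀ : ℝ) (hc₀ : c₀ ≠ 0)
    (hcenter : G Var.center = c₀ • b none)
    (hedge : ∀ i, ∃ c : Fin (n i) → ℝ, (∀ j, c j ≠ 0) ∧
      G (Var.edge i) = ∑ j, c j • b (some (κ i j)))
    (htail : ∀ i j, ∃ c : Fin (n i) → ℝ, G (Var.tailEig i j) = ∑ j, c j • b (some (κ i j)))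
    (hspan : ∀ i j, b (some (κ i j)) ∈
      Submodule.span ℝ (insert (G (Var.edge i)) (Set.range fun j => G (Var.tailEig i j)))) :
    ∃ S : Set (Var n), Var.center ∈ S ∧ (∀ i j, Var.armEig i j ∉ S) ∧
      (∀ i j, Var.tailEig i j ∈ S → Var.edge i ∈ S) ∧ LinearIndepOn ℝ G S ∧
      Submodule.span ℝ (G '' S) = ⊤ := by
  classical
  -- Indices of the constant and of the poles of the arms in `T`; the selection after these arms has
  -- to span exactly these basis vectors.
  let W : Finset (Fin k) → Set (Option (Fin u)) := fun T =>
    insert none {m | ∃ i ∈ T, ∃ j, m = some (κ i j)}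
  suffices h : ∀ T : Finset (Fin k), ∃ S : Set (Var n), Var.center ∈ S ∧
      (∀ i j, Var.armEig i j ∉ S) ∧ (∀ i j, Var.tailEig i j ∈ S → Var.edge i ∈ S) ∧
      LinearIndepOn ℝ G S ∧ Submodule.span ℝ (G '' S) = Submodule.span ℝ (b '' W T) by
    obtain ⟨S, h1, h2, h3, h4, h5⟩ := h Finset.univ
    refine ⟨S, h1, h2, h3, h4, ?_⟩
    have hW : W Finset.univ = Set.univ := by
      refine Set.eq_univ_of_forall fun m => ?_
      rcases m with _ | m
      · exact Set.mem_insert _ _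
      · obtain ⟨i, j, rfl⟩ := hκs m
        exact Set.mem_insert_of_mem _ ⟨i, Finset.mem_univ i, j, rfl⟩
    rw [h5, hW, Set.image_univ, b.span_eq]
  intro T
  induction T using Finset.induction_on with
  | empty =>
    refine ⟨{Var.center}, rfl, by simp, by simp, ?_, ?_⟩
    · rw [linearIndepOn_singleton_iff, hcenter]
      exact smul_ne_zero hc₀ (b.ne_zero _)
    · have : W ∅ = {none} := by ext m; simp [W]
      rw [this, Set.image_singleton, Set.image_singleton, hcenter]
      exact Submodule.span_singleton_smul_eq hc₀.isUnit _
  | insert i T _ ih =>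
    obtain ⟨S, h1, h2, h3, h4, h5⟩ := ih
    have hmono : W T ⊆ W (insert i T) := by
      rintro m (rfl | ⟨i', hi', j, rfl⟩)
      · exact Set.mem_insert _ _
      · exact Set.mem_insert_of_mem _ ⟨i', Finset.mem_insert_of_mem hi', j, rfl⟩
    have hnew : ∀ j, some (κ i j) ∈ W (insert i T) := fun j =>
      Set.mem_insert_of_mem _ ⟨i, Finset.mem_insert_self _ _, j, rfl⟩
    have hsumW : ∀ c : Fin (n i) → ℝ, ∑ j, c j • b (some (κ i j)) ∈
        Submodule.span ℝ (b '' W (insert i T)) := fun c =>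
      Submodule.sum_mem _ fun j _ => Submodule.smul_mem _ _
        (Submodule.subset_span (Set.mem_image_of_mem _ (hnew j)))
    obtain ⟨c, hc, hce⟩ := hedge i
    -- If the edge vector is already in the span, its nonzero coefficients put every pole of arm `i`
    -- into `W T`, and the arm contributes no variable.
    by_cases hmem : G (Var.edge i) ∈ Submodule.span ℝ (b '' W T)
    · refine ⟨S, h1, h2, h3, h4, ?_⟩
      have hsub : W (insert i T) = W T := by
        refine Set.Subset.antisymm ?_ hmono
        rintro m (rfl | ⟨i', hi', j, rfl⟩)
        · exact Set.mem_insert _ _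
        · rcases Finset.mem_insert.1 hi' with rfl | hi'
          · rw [b.mem_span_image] at hmem
            refine hmem ?_
            rw [Finset.mem_coe, Finsupp.mem_support_iff, hce]
            simp only [map_sum, map_smul, b.repr_self, Finsupp.coe_finsetSum, Finset.sum_apply,
              Finsupp.smul_apply, smul_eq_mul]
            rw [Finset.sum_eq_single j (fun j' _ hj' => ?_) (by simp)]
            · simpa using hc j
            · rw [Finsupp.single_eq_of_ne, mul_zero]
              simpa using (hκ i').ne hj'.symm
          · exact Set.mem_insert_of_mem _ ⟨i', hi', j, rfl⟩
      rw [h5, hsub]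
    · have hS1 : LinearIndepOn ℝ G (insert (Var.edge i) S) := by
        refine h4.insert ?_
        rwa [h5]
      -- The edge vector is inserted before the set is enlarged by tails of the same arm, so no tail
      -- is chosen without its edge.
      obtain ⟨S', hS'1, hS'2, hS'3, hS'4⟩ := exists_linearIndepOn_extension hS1
        (Set.subset_union_left (t := Set.range fun j => Var.tailEig i j))
      have hedgeS : Var.edge i ∈ S' := hS'2 (Set.mem_insert _ _)
      refine ⟨S', hS'2 (Set.mem_insert_of_mem _ h1), ?_, ?_, hS'4, le_antisymm ?_ ?_⟩
      · intro i' j h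
        rcases hS'1 h with (h | h) | ⟨j', h⟩
        · simp at h
        · exact h2 _ _ h
        · simp at h
      · intro i' j h
        rcases hS'1 h with (h | h) | ⟨j', h⟩
        · simp at h
        · exact hS'2 (Set.mem_insert_of_mem _ (h3 _ _ h))
        · obtain rfl : i = i' := by
            simp only [Sum.inr.injEq, Sigma.mk.injEq] at h
            exact h.1
          exact hedgeS
      · rw [Submodule.span_le]
        rintro _ ⟨w, hw, rfl⟩
        rcases hS'1 hw with (rfl | h) | ⟨j', rfl⟩
        · rw [hce]
          exact hsumW c
        · have : G w ∈ Submodule.span ℝ (b '' W T) :=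
            h5 ▸ Submodule.subset_span (Set.mem_image_of_mem _ h)
          exact Submodule.span_mono (Set.image_mono hmono) this
        · obtain ⟨c', hc'⟩ := htail i j'
          rw [hc']
          exact hsumW c'
      · have hold : Submodule.span ℝ (b '' W T) ≤ Submodule.span ℝ (G '' S') := by
          rw [← h5]
          exact Submodule.span_mono (Set.image_mono ((Set.subset_insert _ _).trans hS'2))
        rw [Submodule.span_le]
        rintro _ ⟨m, hm, rfl⟩
        rcases hm with rfl | ⟨i', hi', j, rfl⟩
        · exact hold (Submodule.subset_span (Set.mem_image_of_mem _ (Set.mem_insert _ _)))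
        · rcases Finset.mem_insert.1 hi' with rfl | hi'
          · refine Submodule.span_le.2 ?_ (hspan i' j)
            rintro _ (rfl | ⟨j', rfl⟩)
            · exact Submodule.subset_span (Set.mem_image_of_mem _ hedgeS)
            · exact hS'3 (Set.mem_image_of_mem _ (Or.inr ⟨j', rfl⟩))
          · exact hold (Submodule.subset_span
              (Set.mem_image_of_mem _ (Set.mem_insert_of_mem _ ⟨i', hi', j, rfl⟩)))

/-- A linearly independent spanning set of vectors of `ℝ ^ m` is the set of columns of a
nonsingular matrix. -/
theorem exists_injective_det_ne_zero {σ : Type*} [Finite σ] {m : ℕ} {G : σ → Fin m → ℝ}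
    {S : Set σ} (hS : LinearIndepOn ℝ G S) (hspan : Submodule.span ℝ (G '' S) = ⊤) :
    ∃ s : Fin m → σ, Function.Injective s ∧ Set.range s = S ∧
      (Matrix.of fun l c => G (s c) l).det ≠ 0 := by
  classical
  have := Fintype.ofFinite σ
  let B := Module.Basis.mk hS (by rw [← Set.image_eq_range, hspan])
  have hcard : Fintype.card S = m := by
    rw [← Module.finrank_eq_card_basis B, Module.finrank_fin_fun]
  let e : Fin m ≃ S := (Fintype.equivFinOfCardEq hcard).symm
  refine ⟨fun c => e c, Subtype.val_injective.comp e.injective, ?_, ?_⟩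
  · rw [show (fun c => (e c : σ)) = Subtype.val ∘ e from rfl, e.surjective.range_comp,
      Subtype.range_val]
  · have hli : LinearIndependent ℝ (Matrix.of fun l c => G (e c) l).col :=
      hS.comp e e.injective
    exact ((Matrix.isUnit_iff_isUnit_det _).1
      (Matrix.linearIndependent_cols_iff_isUnit.1 hli)).ne_zero

/-! ### The smooth local parametrization of matrices of the star. -/

/-- The matrix of a generalized star with central entry `a₀`, edge entries `a i` and arms `J i`. -/
def starMatrix {k : ℕ} {n : Fin k → ℕ} (a₀ : ℝ) (a : Fin k → ℝ)
    (J : ∀ i, Matrix (Fin (n i)) (Fin (n i)) ℝ) : Matrix (Vertex n) (Vertex n) ℝ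
  | none, none => a₀
  | none, some b => if b.2.val = 0 then a b.1 else 0
  | some b, none => if b.2.val = 0 then a b.1 else 0
  | some b, some c => Matrix.blockDiagonal' J b c

theorem arm_starMatrix {k : ℕ} {n : Fin k → ℕ} (a₀ : ℝ) (a : Fin k → ℝ)
    (J : ∀ i, Matrix (Fin (n i)) (Fin (n i)) ℝ) (i : Fin k) : arm (starMatrix a₀ a J) i = J i := by
  ext p q
  exact Matrix.blockDiagonal'_apply_eq J i p q

theorem starMatrix_mem {k : ℕ} {n : Fin k → ℕ} (a₀ : ℝ) {a : Fin k → ℝ} (ha : ∀ i, a i ≠ 0)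
    {J : ∀ i, Matrix (Fin (n i)) (Fin (n i)) ℝ}
    (hJ : ∀ i, J i ∈ MatricesWithGraph (SimpleGraph.pathGraph (n i))) :
    starMatrix a₀ a J ∈ MatricesWithGraph (starGraph n) := by
  refine ⟨Matrix.IsSymm.ext ?_, ?_⟩
  · rintro (_ | ⟨i, p⟩) (_ | ⟨j, q⟩)
    · rfl
    · rfl
    · rfl
    · simp only [starMatrix]
      by_cases h : i = j
      · subst h
        rw [Matrix.blockDiagonal'_apply_eq, Matrix.blockDiagonal'_apply_eq, (hJ i).1.apply]
      · rw [Matrix.blockDiagonal'_apply_ne _ _ _ h, Matrix.blockDiagonal'_apply_ne _ _ _ (Ne.symm h)]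
  · rintro (_ | ⟨i, p⟩) (_ | ⟨j, q⟩) hne
    · exact absurd rfl hne
    · simp [starMatrix, starGraph, edgeRel, ha]
    · simp [starMatrix, starGraph, edgeRel, ha]
    · simp only [starMatrix]
      by_cases h : i = j
      · subst h
        have hpq : p ≠ q := by rintro rfl; exact hne rfl
        rw [Matrix.blockDiagonal'_apply_eq, (hJ i).2 p q hpq, SimpleGraph.pathGraph_adj]
        simp [starGraph, edgeRel, hpq]
        omega
      · rw [Matrix.blockDiagonal'_apply_ne _ _ _ h]
        simp [starGraph, edgeRel, h, Ne.symm h]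

theorem starMatrix_eq {k : ℕ} {n : Fin k → ℕ} (hn : ∀ i, 0 < n i)
    {A : Matrix (Vertex n) (Vertex n) ℝ} (hA : A ∈ MatricesWithGraph (starGraph n)) :
    starMatrix (A none none) (fun i => A none (some ⟨i, ⟨0, hn i⟩⟩)) (arm A) = A := by
  have h : ∀ b : Σ i, Fin (n i),
      (if b.2.val = 0 then A none (some ⟨b.1, ⟨0, hn b.1⟩⟩) else 0) = A none (some b) := by
    rintro ⟨i, p⟩
    split_ifs with hp
    · obtain rfl : p = ⟨0, hn i⟩ := Fin.ext hp
      rfl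
    · exact (apply_none_some_of_ne hA hp).symm
  ext (_ | b) (_ | c)
  · rfl
  · exact h c
  · exact (h b).trans (hA.1.apply _ _)
  · exact congrFun (congrFun (submatrix_some_eq hA).symm b) c

theorem exists_hasVars {k : ℕ} {n : Fin k → ℕ} (hn : ∀ i, 0 < n i)
    {A : Matrix (Vertex n) (Vertex n) ℝ} (hA : A ∈ MatricesWithGraph (starGraph n)) :
    ∃ x : Var n → ℝ, HasVars A x := by
  have htail : ∀ {N : ℕ} (_ : 0 < N) {B : Matrix (Fin N) (Fin N) ℝ}
      (_ : B ∈ MatricesWithGraph (SimpleGraph.pathGraph N)),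
      ∃ η : Fin (N - 1) → ℝ, StrictMono η ∧
        (B.submatrix (Subtype.val : {p : Fin N // p.val ≠ 0} → _) Subtype.val).charpoly
          = ∏ j, (X - C (η j)) := by
    intro N hN B hB
    obtain ⟨N, rfl⟩ : ∃ K, N = K + 1 := ⟨N - 1, by omega⟩
    rw [charpoly_submatrix_val_ne_zero]
    exact exists_strictMono_charpoly_eq (submatrix_succ_mem hB)
  choose γ hγ hγ' using fun i => exists_strictMono_charpoly_eq (arm_mem hA i)
  choose η hη hη' using fun i => htail (hn i) (arm_mem hA i)
  refine ⟨Sum.elim (fun _ => A none none) (Sum.elim (fun i => A none (some ⟨i, ⟨0, hn i⟩⟩))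
    (Sum.elim (fun a => γ a.1 a.2) fun a => η a.1 a.2)), rfl, fun i p hp => ?_, hγ, hγ', hη, hη'⟩
  obtain rfl : p = ⟨0, hn i⟩ := Fin.ext hp
  rfl

/-- The central and edge entries are themselves variables, and the arms come from the inverse
spectral problem. Nonzero edges and strictly increasing lists are open conditions that hold at `x₀`,
so one open `U` serves them all. -/
theorem exists_isLocalParametrization {k : ℕ} {n : Fin k → ℕ} (hn : ∀ i, 0 < n i)
    {A : Matrix (Vertex n) (Vertex n) ℝ} (hA : A ∈ MatricesWithGraph (starGraph n)) :
    ∃ (x₀ : Var n → ℝ) (U : Set (Var n → ℝ)) (M : (Var n → ℝ) → Matrix (Vertex n) (Vertex n) ℝ),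
      IsLocalParametrization A x₀ U M := by
  obtain ⟨x₀, hx₀⟩ := exists_hasVars hn hA
  have hev : ∀ v : Var n, ContDiff ℝ ∞ fun x : Var n → ℝ => x v := fun v => contDiff_apply _ _ v
  choose J hJ₀ hJ using fun i => exists_jacobi_family_of_eigenvalues x₀ (hn i) (arm_mem hA i)
    (fun j x => x (Var.armEig i j)) (fun j => hev _) (fun j x => x (Var.tailEig i j))
    (fun j => hev _) (hx₀.arm_charpoly i) (hx₀.tail_charpoly i)
  let M : (Var n → ℝ) → Matrix (Vertex n) (Vertex n) ℝ := fun x =>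
    starMatrix (x Var.center) (fun i => x (Var.edge i)) fun i => J i x
  have hcont : ∀ v : Var n, Tendsto (fun x : Var n → ℝ => x v) (𝓝 x₀) (𝓝 (x₀ v)) := fun v =>
    (continuous_apply v).tendsto _
  have hmono : ∀ {N : ℕ} (v : Fin N → Var n), (StrictMono fun j => x₀ (v j)) →
      ∀ᶠ x in 𝓝 x₀, StrictMono fun j => x (v j) := by
    intro N v hv
    have : ∀ᶠ x in 𝓝 x₀, ∀ p q, p < q → x (v p) < x (v q) := by
      simp only [eventually_all]
      intro p q hpq
      exact (hcont _).eventually_lt (hcont _) (hv hpq)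
    exact this.mono fun x hx p q => hx p q
  have hedge : ∀ i, x₀ (Var.edge i) ≠ 0 := fun i => by
    rw [← hx₀.edge i ⟨0, hn i⟩ rfl]
    exact apply_none_some_ne_zero hA rfl
  have hall : ∀ᶠ x in 𝓝 x₀, (∀ v w, ContDiffAt ℝ ∞ (fun y => M y v w) x) ∧
      M x ∈ MatricesWithGraph (starGraph n) ∧ HasVars (M x) x := by
    filter_upwards [eventually_all.2 hJ,
      eventually_all.2 fun i => hmono _ (hx₀.arm_strictMono i),
      eventually_all.2 fun i => hmono _ (hx₀.tail_strictMono i),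
      eventually_all.2 fun i => (hcont (Var.edge i)).eventually_ne (hedge i)] with x h1 h2 h3 h4
    refine ⟨?_, starMatrix_mem _ h4 fun i => (h1 i).1, rfl, fun i p hp => ?_, h2, fun i => ?_, h3,
      fun i => ?_⟩
    · rintro (_ | ⟨i, p⟩) (_ | ⟨j, q⟩)
      · exact (hev _).contDiffAt
      · simp only [M, starMatrix]
        split_ifs
        · exact (hev _).contDiffAt
        · exact contDiffAt_const
      · simp only [M, starMatrix]
        split_ifs
        · exact (hev _).contDiffAt
        · exact contDiffAt_const
      · simp only [M, starMatrix]
        by_cases h : i = j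
        · subst h
          simp only [Matrix.blockDiagonal'_apply_eq]
          exact (h1 i).2.1 p q
        · simp only [Matrix.blockDiagonal'_apply_ne _ _ _ h]
          exact contDiffAt_const
    · simp [M, starMatrix, hp]
    · rw [arm_starMatrix]
      exact (h1 i).2.2.1
    · rw [armTail, arm_starMatrix]
      exact (h1 i).2.2.2
  obtain ⟨U, hU, hUo, hxU⟩ := mem_nhds_iff.1 hall
  refine ⟨x₀, U, M, hUo, hxU, ?_, fun v w x hx => ((hU hx).1 v w).contDiffWithinAt,
    fun x hx => (hU hx).2.1, fun x hx => (hU hx).2.2⟩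
  simp only [M]
  rw [← hx₀.center]
  simp only [hJ₀]
  have : (fun i => x₀ (Var.edge i)) = fun i => A none (some ⟨i, ⟨0, hn i⟩⟩) :=
    funext fun i => (hx₀.edge i _ rfl).symm
  rw [this, starMatrix_eq hn hA]

/-! ### The Jacobian through derivatives of the secular function. -/

theorem det_sub_smul_one_eq {k : ℕ} {n : Fin k → ℕ} (hn : ∀ i, 0 < n i)
    {A : Matrix (Vertex n) (Vertex n) ℝ} (hA : A ∈ MatricesWithGraph (starGraph n))
    {x : Var n → ℝ} (hx : HasVars A x) {t : ℝ} (ht : ∀ i j, t ≠ x (Var.armEig i j)) :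
    (A - t • (1 : Matrix _ _ ℝ)).det = (-1) ^ Fintype.card (Vertex n) *
      (∏ i, ∏ j, (t - x (Var.armEig i j))) * (t - x Var.center - ∑ i, x (Var.edge i) ^ 2 *
        ((∏ j, (t - x (Var.tailEig i j))) / ∏ j, (t - x (Var.armEig i j)))) := by
  have hP : ∀ i, (arm A i).charpoly.eval t = ∏ j, (t - x (Var.armEig i j)) := fun i => by
    simp [hx.arm_charpoly, eval_prod]
  have hR : ∀ i, (armTail A i).charpoly.eval t = ∏ j, (t - x (Var.tailEig i j)) := fun i => by
    simp [hx.tail_charpoly, eval_prod]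
  have h : A - t • (1 : Matrix _ _ ℝ) = -(Matrix.scalar (Vertex n) t - A) := by
    rw [neg_sub, Matrix.scalar_apply, Matrix.smul_one_eq_diagonal]
  rw [h, Matrix.det_neg, ← Matrix.eval_charpoly, eval_charpoly_star hn hA fun i => ?_, mul_assoc]
  · simp only [hP, hR, hx.center, fun i => hx.edge i ⟨0, hn i⟩ rfl]
  · rw [hP]
    exact Finset.prod_ne_zero_iff.2 fun j _ => sub_ne_zero.2 (ht i j)

/-- The derivative in the direction of the variable `c`, other than an eigenvalue of an arm, of
the secular function at `t`. -/
noncomputable def secularDeriv {k : ℕ} {n : Fin k → ℕ} (x : Var n → ℝ) (t : ℝ) (c : Var n) : ℝ :=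
  -(Pi.single c 1 : Var n → ℝ) Var.center - ∑ i,
    (2 * x (Var.edge i) * (Pi.single c 1 : Var n → ℝ) (Var.edge i) *
        ((∏ j, (t - x (Var.tailEig i j))) / ∏ j, (t - x (Var.armEig i j)))
      + x (Var.edge i) ^ 2 * ((∑ j, (∏ m ∈ Finset.univ.erase j, (t - x (Var.tailEig i m))) *
        -(Pi.single c 1 : Var n → ℝ) (Var.tailEig i j)) / ∏ j, (t - x (Var.armEig i j))))

theorem secularDeriv_center {k : ℕ} {n : Fin k → ℕ} (x : Var n → ℝ) (t : ℝ) :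
    secularDeriv x t Var.center = -1 := by
  simp [secularDeriv]

theorem secularDeriv_edge {k : ℕ} {n : Fin k → ℕ} (x : Var n → ℝ) (t : ℝ) (i : Fin k) :
    secularDeriv x t (Var.edge i) = -(2 * x (Var.edge i)) *
      ((∏ j, (t - x (Var.tailEig i j))) / ∏ j, (t - x (Var.armEig i j))) := by
  simp only [secularDeriv]
  rw [Finset.sum_eq_single i (fun i' _ hi' => by simp [hi']) (by simp)]
  simp

theorem secularDeriv_tailEig {k : ℕ} {n : Fin k → ℕ} (x : Var n → ℝ) (t : ℝ) (i : Fin k)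
    (j : Fin (n i - 1)) : secularDeriv x t (Var.tailEig i j) = x (Var.edge i) ^ 2 *
      ((∏ m ∈ Finset.univ.erase j, (t - x (Var.tailEig i m))) / ∏ j, (t - x (Var.armEig i j))) := by
  simp only [secularDeriv]
  rw [Finset.sum_eq_single i (fun i' _ hi' => by simp [hi']) (by simp),
    Finset.sum_eq_single j (fun j' _ hj' => by simp [hj']) (by simp)]
  simp
  ring

/-- As `c` is not an eigenvalue of an arm, the denominators are constant and only the numerators are
differentiated. -/
theorem hasDerivAt_secular {k : ℕ} {n : Fin k → ℕ} (x : Var n → ℝ) (t : ℝ) {c : Var n}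
    (hc : ∀ i j, c ≠ Var.armEig i j) :
    HasDerivAt (fun r => t - Function.update x c r Var.center -
      ∑ i, Function.update x c r (Var.edge i) ^ 2 *
        ((∏ j, (t - Function.update x c r (Var.tailEig i j))) /
          ∏ j, (t - Function.update x c r (Var.armEig i j))))
      (secularDeriv x t c) (x c) := by
  -- Differentiating every coordinate by `Pi.single c 1` treats the centre, the edges and the tails
  -- by one formula.
  have hu : ∀ v, HasDerivAt (fun r => Function.update x c r v) ((Pi.single c 1 : Var n → ℝ) v)
      (x c) := hasDerivAt_pi.1 (hasDerivAt_update x c (x c))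
  have hx : Function.update x c (x c) = x := Function.update_eq_self _ _
  have harm : ∀ r i j, Function.update x c r (Var.armEig i j) = x (Var.armEig i j) :=
    fun r i j => Function.update_of_ne (hc i j).symm _ _
  simp only [harm]
  refine ((hu _).const_sub t).sub (HasDerivAt.fun_sum fun i _ => ?_)
  have h1 := (hu (Var.edge i)).pow 2
  have h2 := (HasDerivAt.fun_finsetProd (u := Finset.univ)
    (f := fun j r => t - Function.update x c r (Var.tailEig i j)) (x := x c)
    fun j _ => (hu (Var.tailEig i j)).const_sub t).div_const (∏ j, (t - x (Var.armEig i j)))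
  have h3 := h1.mul h2
  simp only [hx, smul_eq_mul] at h3
  convert! h3 using 1
  simp

/-- The secular formula for the determinant holds on `U`, which suffices for a derivative at `x₀`.
Its prefactor involves only arm eigenvalues, so it is constant along `s c` and depends on the row
alone. -/
theorem jacobian_apply_eq {k : ℕ} {n : Fin k → ℕ} (hn : ∀ i, 0 < n i)
    {A : Matrix (Vertex n) (Vertex n) ℝ} {x₀ : Var n → ℝ} {U : Set (Var n → ℝ)}
    {M : (Var n → ℝ) → Matrix (Vertex n) (Vertex n) ℝ} (hM : IsLocalParametrization A x₀ U M)
    {ι κ : Type*} (lam : ι → ℝ) (hlam : ∀ l i j, lam l ≠ x₀ (Var.armEig i j)) (s : κ → Var n)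
    (hs : ∀ c i j, s c ≠ Var.armEig i j) (l : ι) (c : κ) :
    jacobian (fun l x => (M x - lam l • (1 : Matrix _ _ ℝ)).det) x₀ s l c =
      ((-1) ^ Fintype.card (Vertex n) * ∏ i, ∏ j, (lam l - x₀ (Var.armEig i j))) *
        secularDeriv x₀ (lam l) (s c) := by
  have harm : ∀ r i j, Function.update x₀ (s c) r (Var.armEig i j) = x₀ (Var.armEig i j) :=
    fun r i j => Function.update_of_ne (hs c i j).symm _ _
  have hU : ∀ᶠ r in 𝓝 (x₀ (s c)), Function.update x₀ (s c) r ∈ U := by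
    have hcont : ContinuousAt (fun r => Function.update x₀ (s c) r) (x₀ (s c)) :=
      (hasDerivAt_update x₀ (s c) _).continuousAt
    refine hcont.eventually_mem ?_
    rw [Function.update_eq_self]
    exact hM.isOpen.mem_nhds hM.mem
  refine HasDerivAt.deriv (((hasDerivAt_secular x₀ (lam l) (hs c)).const_mul _).congr_of_eventuallyEq
    ?_)
  filter_upwards [hU] with r hr
  rw [det_sub_smul_one_eq hn (hM.mem_graph _ hr) (hM.hasVars _ hr)
    fun i j => by rw [harm]; exact hlam l i j]
  simp only [harm]

/-- The derivatives of the secular function at the points `lam l` contain a basis, with an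
eigenvalue of a tail selected only together with the edge entry of its arm. -/
theorem exists_linearIndepOn_secularDeriv {k u : ℕ} {n : Fin k → ℕ} (hn : ∀ i, 0 < n i)
    {x : Var n → ℝ} {μ : Fin u → ℝ} {lam : Fin (u + 1) → ℝ} (hμ : Function.Injective μ)
    (hlam : Function.Injective lam) (hlamμ : ∀ l m, lam l ≠ μ m)
    (hγ : ∀ i, Function.Injective fun j => x (Var.armEig i j))
    (hη : ∀ i, Function.Injective fun j => x (Var.tailEig i j))
    (hγη : ∀ i j m, x (Var.armEig i j) ≠ x (Var.tailEig i m))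
    (hedge : ∀ i, x (Var.edge i) ≠ 0) (hpole : ∀ i j, ∃ m, μ m = x (Var.armEig i j))
    (hpole' : ∀ m, ∃ i j, μ m = x (Var.armEig i j)) :
    ∃ S : Set (Var n), Var.center ∈ S ∧ (∀ i j, Var.armEig i j ∉ S) ∧
      (∀ i j, Var.tailEig i j ∈ S → Var.edge i ∈ S) ∧
      LinearIndepOn ℝ (fun c l => secularDeriv x (lam l) c) S ∧
      Submodule.span ℝ ((fun c l => secularDeriv x (lam l) c) '' S) = ⊤ := by
  -- `κ i j` is the index of the `j`-th eigenvalue of arm `i` among the upward eigenvalues;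
  -- different arms may share an index.
  choose κ hκ using hpole
  have hne : ∀ l i j, lam l ≠ x (Var.armEig i j) := fun l i j => hκ i j ▸ hlamμ l _
  let b := basisOfLinearIndependentOfCardEqFinrank
    (linearIndependent_simpleFraction hμ hlam hlamμ) (by simp)
  have hbn : b none = 1 := by simp [b, simpleFraction]
  have hbs : ∀ i j, b (some (κ i j)) = fun l => (lam l - x (Var.armEig i j))⁻¹ := fun i j => by
    simp [b, simpleFraction, hκ]
  refine exists_linearIndepOn_selection b _ κ (fun i j j' h => hγ i ?_) (fun m => ?_) (-1)
    (by norm_num) ?_ (fun i => ?_) (fun i j => ?_) fun i j => ?_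
  · simp only [← hκ, h]
  · obtain ⟨i, j, h⟩ := hpole' m
    exact ⟨i, j, hμ (by rw [hκ, h])⟩
  · ext l
    simp [secularDeriv_center, hbn]
  · obtain ⟨c, hc, h⟩ := exists_edge_partialFraction (hγ i) (hn i) (hγη i)
    refine ⟨fun j => -(2 * x (Var.edge i)) * c j, fun j => ?_, ?_⟩
    · exact mul_ne_zero (neg_ne_zero.2 (mul_ne_zero two_ne_zero (hedge i))) (hc j)
    · ext l
      rw [secularDeriv_edge, h _ (hne l i), Finset.sum_apply, Finset.mul_sum]
      refine Finset.sum_congr rfl fun j _ => ?_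
      rw [hbs, Pi.smul_apply, smul_eq_mul, mul_assoc]
  · obtain ⟨c, h⟩ := exists_tail_partialFraction (hγ i) (fun m => x (Var.tailEig i m)) j
    refine ⟨fun m => x (Var.edge i) ^ 2 * c m, ?_⟩
    ext l
    rw [secularDeriv_tailEig, h _ (hne l i), Finset.sum_apply, Finset.mul_sum]
    refine Finset.sum_congr rfl fun m _ => ?_
    rw [hbs, Pi.smul_apply, smul_eq_mul, mul_assoc]
  · obtain ⟨d, h⟩ := exists_simpleFraction_eq (γ := fun m => x (Var.armEig i m)) (hη i) j
    have ha := hedge i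
    -- The expansion of a simple fraction, with the factors `-2 a_i` and `a_i²` of the derivatives
    -- divided out.
    have heq : b (some (κ i j)) =
        (-(2 * x (Var.edge i)))⁻¹ • (fun l => secularDeriv x (lam l) (Var.edge i)) +
        ∑ m, (d m * (x (Var.edge i) ^ 2)⁻¹) • fun l => secularDeriv x (lam l) (Var.tailEig i m) := by
      ext l
      rw [(congrFun (hbs i j) l).trans (h _ (hne l i)), Pi.add_apply, Finset.sum_apply,
        Pi.smul_apply, secularDeriv_edge,
        smul_eq_mul, inv_mul_cancel_left₀ (neg_ne_zero.2 (mul_ne_zero two_ne_zero ha))]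
      congr 1
      refine Finset.sum_congr rfl fun m _ => ?_
      rw [Pi.smul_apply, smul_eq_mul, secularDeriv_tailEig, mul_assoc,
        inv_mul_cancel_left₀ (pow_ne_zero 2 ha)]
    rw [heq]
    exact Submodule.add_mem _ (Submodule.smul_mem _ _ (Submodule.subset_span (Set.mem_insert _ _)))
      (Submodule.sum_mem _ fun m _ => Submodule.smul_mem _ _
        (Submodule.subset_span (Set.mem_insert_of_mem _ ⟨m, rfl⟩)))

end GenStar
theorem mainTheorem4 {k : ℕ} (n : Fin k → ℕ) (hn : ∀ i, 0 < n i)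
    (A : Matrix (GenStar.Vertex n) (GenStar.Vertex n) ℝ)
    (hA : A ∈ GenStar.MatricesWithGraph (GenStar.starGraph n))
    {u : ℕ} (q : Fin u → ℕ) (μ : Fin u → ℝ) (lam : Fin (u + 1) → ℝ)
    (hlist : GenStar.HasUpwardList A none q μ lam) :
    ∃ (x₀ : GenStar.Var n → ℝ) (U : Set (GenStar.Var n → ℝ))
      (M : (GenStar.Var n → ℝ) → Matrix (GenStar.Vertex n) (GenStar.Vertex n) ℝ),
      GenStar.IsLocalParametrization A x₀ U M ∧
      ∃ s : Fin (u + 1) → GenStar.Var n,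
        Function.Injective s ∧
        GenStar.Var.center ∈ Set.range s ∧
        (∀ i j, GenStar.Var.armEig i j ∉ Set.range s) ∧
        (∀ i j, GenStar.Var.tailEig i j ∈ Set.range s → GenStar.Var.edge i ∈ Set.range s) ∧
        (GenStar.jacobian (fun j x => (M x - lam j • (1 : Matrix _ _ ℝ)).det) x₀ s).det ≠ 0 := by
  classical
  obtain ⟨x₀, U, M, hM⟩ := GenStar.exists_isLocalParametrization hn hA
  have hx : GenStar.HasVars A x₀ := hM.apply_base ▸ hM.hasVars x₀ hM.mem
  have hP : ∀ i t, (GenStar.arm A i).charpoly.eval t = ∏ j, (t - x₀ (GenStar.Var.armEig i j)) :=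
    fun i t => by simp [hx.arm_charpoly, Polynomial.eval_prod]
  have hup : ∀ t, GenStar.IsUpward A none t ↔ ∃ i j, t = x₀ (GenStar.Var.armEig i j) := fun t => by
    simp only [GenStar.isUpward_iff_exists_arm hn hA, hP, Finset.prod_eq_zero_iff, Finset.mem_univ,
      true_and, sub_eq_zero]
  have hlam : ∀ l, ¬ GenStar.IsUpward A none (lam l) := fun l =>
    ((hlist.isNonUpward_iff _).2 ⟨l, rfl⟩).2
  have hne : ∀ l i j, lam l ≠ x₀ (GenStar.Var.armEig i j) := fun l i j h =>
    hlam l ((hup _).2 ⟨i, j, h⟩)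
  obtain ⟨S, hS1, hS2, hS3, hS4, hS5⟩ := GenStar.exists_linearIndepOn_secularDeriv hn
    hlist.mu_strictMono.injective hlist.lam_strictMono.injective
    (fun l m h => hlam l ((hlist.isUpward_iff _).2 ⟨m, h.symm⟩))
    (fun i => (hx.arm_strictMono i).injective) (fun i => (hx.tail_strictMono i).injective)
    -- A common eigenvalue of an arm and its tail would make their Wronskian vanish.
    (fun i j m h => by
      have hw := GenStar.wronskian_arm_pos hn A i (x₀ (GenStar.Var.armEig i j)) hA
      rw [hP, Finset.prod_eq_zero (Finset.mem_univ j) (sub_self _), hx.tail_charpoly,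
        Polynomial.eval_prod, Finset.prod_eq_zero (Finset.mem_univ m) (by simp [h])] at hw
      simp at hw)
    (fun i => by
      rw [← hx.edge i ⟨0, hn i⟩ rfl]
      exact GenStar.apply_none_some_ne_zero hA rfl)
    (fun i j => (hlist.isUpward_iff _).1 ((hup _).2 ⟨i, j, rfl⟩))
    (fun m => (hup _).1 ((hlist.isUpward_iff _).2 ⟨m, rfl⟩))
  obtain ⟨s, hs, hrange, hdet⟩ := GenStar.exists_injective_det_ne_zero hS4 hS5
  refine ⟨x₀, U, M, hM, s, hs, hrange ▸ hS1, hrange ▸ hS2, hrange ▸ hS3, ?_⟩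
  have hsa : ∀ c i j, s c ≠ GenStar.Var.armEig i j := fun c i j h =>
    hS2 i j (h ▸ hrange ▸ Set.mem_range_self c)
  -- The Jacobian is a nonsingular matrix with row `l` scaled by `± ∏ p_i(λ_l)`, which is nonzero
  -- because `λ_l` is not an eigenvalue of any arm.
  have hJ : GenStar.jacobian (fun j x => (M x - lam j • (1 : Matrix _ _ ℝ)).det) x₀ s =
      Matrix.of fun l c => ((-1) ^ Fintype.card (GenStar.Vertex n) *
        ∏ i, ∏ j, (lam l - x₀ (GenStar.Var.armEig i j))) *
          (Matrix.of fun l c => GenStar.secularDeriv x₀ (lam l) (s c)) l c := by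
    ext l c
    exact GenStar.jacobian_apply_eq hn hM lam hne s hsa l c
  rw [hJ, Matrix.det_mul_column]
  refine mul_ne_zero (Finset.prod_ne_zero_iff.2 fun l _ => mul_ne_zero (by simp) ?_) hdet
  exact Finset.prod_ne_zero_iff.2 fun i _ => Finset.prod_ne_zero_iff.2 fun j _ =>
    sub_ne_zero.2 (hne l i j)
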